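/- **Proposition (Lattice point counting).** Let $P\subset\mathbb R^{\bar d}$ ($\bar d\ge 1$) be a rational polytope, and suppose that its generating function is given by a short sum with $N$ terms (an identity of rational functions over $\mathbb Q$) $$f(P;\mathbf y)=\sum_{\alpha\in P\cap\mathbb Z^{\bar d}}\mathbf y^{\alpha}=\sum_{i=1}^{N}\epsilon_i\frac{\mathbf y^{u_i}}{\prod_{j=1}^{\bar d}(1-\mathbf y^{v_{ij}})},\qquad \epsilon_i\in\{\pm1\},\ u_i,v_{ij}\in\mathbb Z^{\bar d},\ v_{ij}\ne 0 .$$ Let $c>1$, and let $p$ be a prime with $p\ge cN\bar d$ (in particular $p$ may be of size $\Theta(N\bar d)$), such that no $v_{ij}$ is congruent to $0$ modulo $p$. Then $f(P;\mathbf 1)=\#(P\cap\mathbb Z^{\bar d})$ modulo $p$ can be computed by a randomized algorithm that is always correct and has expected running time $$O\big(N\log^2(\bar d+1)\,\bar d\big),$$ of which only $O(N\bar d)$ steps, in expectation, are substitutions in monomials. The implied constants depend only on $c$. Here the computation is carried out in a nonzero commutative ring $R\supseteq\mathbb Z_p$ that supports the FFT; it is enough that for some absolute constant $L$, $R$ has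 a given primitive $2^k$-th root of unity for every $k$ with $2^k\le L\bar d$. ($R=\mathbb Z_p$ is allowed if it has these roots.) Running time is the number of steps of a randomized algebraic computation tree, which depends only on $N$, $\bar d$ and $c$, and not on $p$, $R$, $P$ or the given sum. One step is: an addition, subtraction, multiplication or inversion of a unit in $R$; writing down $0$, $1$ or one of the given roots of unity; reading a sign $\epsilon_i$; a zero test; drawing a uniformly random element of $\mathbb Z_p$; or a substitution $y_k=\kappa^{\gamma_k}$ in one of the monomials $\mathbf y^{u_i}$, $\mathbf y^{v_{ij}}$, i.e. obtaining $\langle\gamma,u_i\rangle$ or $\langle\gamma,v_{ij}\rangle$ in $R$ from $\gamma_1,\dots,\gamma_{\bar d}\in R$. -/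

import Mathlib

namespace LatticeCount

/-! ### Rational polytopes and their generating functions -/

/-- A rational polytope in `ℝ^d`: the convex hull of finitely many rational points. -/
def IsRationalPolytope {d : ℕ} (P : Set (Fin d → ℝ)) : Prop :=
  ∃ V : Finset (Fin d → ℚ),
    P = convexHull ℝ ((fun (q : Fin d → ℚ) (k : Fin d) => ((q k : ℚ) : ℝ)) '' (V : Set (Fin d → ℚ)))

/-- The lattice points `P ∩ ℤ^d`. -/
def latticePoints {d : ℕ} (P : Set (Fin d → ℝ)) : Set (Fin d → ℤ) :=
  {α | (fun k => (α k : ℝ)) ∈ P}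

/-- The field of rational functions `ℚ(y_1, …, y_d)`. -/
abbrev RatFun (d : ℕ) : Type := FractionRing (MvPolynomial (Fin d) ℚ)

/-- The Laurent monomial `y^α = y_1^{α_1} ⋯ y_d^{α_d}`. -/
noncomputable def mono {d : ℕ} (α : Fin d → ℤ) : RatFun d :=
  ∏ k, (algebraMap (MvPolynomial (Fin d) ℚ) (RatFun d) (MvPolynomial.X k)) ^ (α k)

/-- `f(P; y) = ∑_{α ∈ P ∩ ℤ^d} y^α`. The sum is finite when `P` is bounded. -/
noncomputable def genFun {d : ℕ} (P : Set (Fin d → ℝ)) : RatFun d :=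
  ∑ᶠ α ∈ latticePoints P, mono α

/-- The data `(ε_i, u_i, v_{ij})` of a short sum with `N` terms in dimension `d`. -/
structure ShortSum (N d : ℕ) where
  sign : Fin N → ℤˣ
  u : Fin N → Fin d → ℤ
  v : Fin N → Fin d → Fin d → ℤ

/-- The rational function `∑_i ε_i y^{u_i} / ∏_j (1 - y^{v_{ij}})`. -/
noncomputable def ShortSum.toRatFun {N d : ℕ} (S : ShortSum N d) : RatFun d :=
  ∑ i, (((S.sign i : ℤˣ) : ℤ) : RatFun d) * (mono (S.u i) / ∏ j, (1 - mono (S.v i j)))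

/-- `S` is a short rational representation of `f(P; y)` (with no zero denominator). -/
def ShortSum.Represents {N d : ℕ} (S : ShortSum N d) (P : Set (Fin d → ℝ)) : Prop :=
  (∀ i j, S.v i j ≠ 0) ∧ genFun P = S.toRatFun

/-! ### Rings in which the fast Fourier transform can be performed -/

/-- Primitive `n`-th roots of unity in a commutative ring, in the sense used for the FFT. -/
def IsPrimRoot {R : Type*} [CommRing R] (ω : R) (n : ℕ) : Prop :=
  ω ^ n = 1 ∧ IsUnit (n : R) ∧ ∀ t : ℕ, t.Prime → t ∣ n → ω ^ (n / t) - 1 ∈ nonZeroDivisors R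

/-! ### Randomized algebraic computation trees

A program keeps a list of elements of the ring `R`, and every computation step appends one
element. Earlier entries are addressed by position, and positions and control flow cannot depend on
ring elements except through explicit zero tests. The syntax does not mention `R`, `p` or the
input, so one and the same program runs over all rings and all inputs. -/

/-- Computation steps; the natural numbers are positions in the list. -/
inductive Op (N d : ℕ) : Type
  | zero : Op N d
  | one : Op N d
  /-- the fixed primitive `2^k`-th root of unity -/
  | root (k : ℕ) : Op N d
  | add (a b : ℕ) : Op N d
  | sub (a b : ℕ) : Op N d
  | mul (a b : ℕ) : Op N d
  /-- inverse of a unit -/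
  | inv (a : ℕ) : Op N d
  /-- read the sign of the `i`-th term -/
  | sign (i : Fin N) : Op N d
  /-- substitute `y_k = κ^{γ_k}` in `y^{u_i}`: the exponent `⟨γ, u_i⟩`, where `γ_k` is the entry
  at position `g k` -/
  | substU (i : Fin N) (g : Fin d → ℕ) : Op N d
  /-- substitute `y_k = κ^{γ_k}` in `y^{v_{ij}}`: the exponent `⟨γ, v_{ij}⟩` -/
  | substV (i : Fin N) (j : Fin d) (g : Fin d → ℕ) : Op N d

/-- The ring element computed by a step. -/
noncomputable def Op.eval {N d : ℕ} {R : Type*} [CommRing R] (ω : ℕ → R) (S : ShortSum N d)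
    (m : List R) : Op N d → R
  | .zero => 0
  | .one => 1
  | .root k => ω k
  | .add a b => m.getD a 0 + m.getD b 0
  | .sub a b => m.getD a 0 - m.getD b 0
  | .mul a b => m.getD a 0 * m.getD b 0
  | .inv a => Ring.inverse (m.getD a 0)
  | .sign i => (((S.sign i : ℤˣ) : ℤ) : R)
  | .substU i g => ∑ k, m.getD (g k) 0 * (S.u i k : R)
  | .substV i j g => ∑ k, m.getD (g k) 0 * (S.v i j k : R)

/-- The price of a step: `b` for the substitution in a monomial, `a` for everything else. -/
def Op.cost {N d : ℕ} (a b : ℝ) : Op N d → ℝ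
  | .substU _ _ => b
  | .substV _ _ _ => b
  | _ => a

/-- Programs. -/
inductive Prog (N d : ℕ) : Type
  /-- stop and output the entry at position `r` -/
  | output (r : ℕ) : Prog N d
  /-- perform a computation step and append its value -/
  | compute (o : Op N d) (next : Prog N d) : Prog N d
  /-- append a uniformly distributed random element of `ℤ/p` -/
  | sample (next : Prog N d) : Prog N d
  /-- test whether the entry at position `r` is zero -/
  | ifZero (r : ℕ) (yes no : Prog N d) : Prog N d

/-- Started with the list `m`, the program outputs `x` whatever the random samples are. -/
def Prog.Outputs {N d : ℕ} (p : ℕ) {R : Type*} [CommRing R] [Algebra (ZMod p) R]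
    (ω : ℕ → R) (S : ShortSum N d) (x : R) : Prog N d → List R → Prop
  | .output r, m => m.getD r 0 = x
  | .compute o t, m => Prog.Outputs p ω S x t (m ++ [o.eval ω S m])
  | .sample t, m => ∀ z : ZMod p, Prog.Outputs p ω S x t (m ++ [algebraMap (ZMod p) R z])
  | .ifZero r t e, m =>
      (m.getD r 0 = 0 → Prog.Outputs p ω S x t m) ∧ (m.getD r 0 ≠ 0 → Prog.Outputs p ω S x e m)

open Classical in
/-- The expected cost of the program started with the list `m`, if a substitution in a monomial
has price `b` and every other step (arithmetic, constants, reading a sign, sampling, zero test)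
has price `a`. -/
noncomputable def Prog.expCost {N d : ℕ} (p : ℕ) [NeZero p] {R : Type*} [CommRing R]
    [Algebra (ZMod p) R] (a b : ℝ) (ω : ℕ → R) (S : ShortSum N d) : Prog N d → List R → ℝ
  | .output _, _ => 0
  | .compute o t, m => o.cost a b + Prog.expCost p a b ω S t (m ++ [o.eval ω S m])
  | .sample t, m =>
      a + (∑ z : ZMod p, Prog.expCost p a b ω S t (m ++ [algebraMap (ZMod p) R z])) / (p : ℝ)
  | .ifZero r t e, m =>
      a + if m.getD r 0 = 0 then Prog.expCost p a b ω S t m else Prog.expCost p a b ω S e m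

/-- Expected running time: every step, including a substitution in a monomial, counts one. -/
noncomputable def Prog.expTime {N d : ℕ} (p : ℕ) [NeZero p] {R : Type*} [CommRing R]
    [Algebra (ZMod p) R] (ω : ℕ → R) (S : ShortSum N d) (T : Prog N d) : ℝ :=
  T.expCost p 1 1 ω S []

/-- Expected number of substitutions in monomials. -/
noncomputable def Prog.expSubst {N d : ℕ} (p : ℕ) [NeZero p] {R : Type*} [CommRing R]
    [Algebra (ZMod p) R] (ω : ℕ → R) (S : ShortSum N d) (T : Prog N d) : ℝ :=
  T.expCost p 0 1 ω S []

end LatticeCount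

/-! Substitute `y_k = e^{γ_k s}` for a direction `γ` modulo `p`. Put `a_ij = ⟨γ, v_ij⟩`, `b_i = ⟨γ,
u_i⟩` and `B(s) = (e^s - 1)/s`. Since `1 - e^{as} = -a s B(as)`, if no `a_ij` vanishes the `i`-th
term has constant Laurent coefficient `∏_j (-a_ij)⁻¹ · [s^d] (e^{b_i s} / ∏_j B(a_ij s))`, and the
signed sum of these is the number of lattice points. Only `1/k!` with `k ≤ d + 1` occurs; for `N ≥
2` these exist because `p > Nd ≥ d + 1`. To justify this over `R`, denominators are cleared: the
identity then holds between integer Laurent polynomials and can be mapped to `R⟦s⟧` by sending `y^α`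
to `w^⟨γ, α⟩`, where `w` is a truncated exponential (`ShortSum.Represents.laurent`,
`ShortSum.Represents.natCast_ncard`). For `N = 0` the count is zero, and `N = 1` cannot occur.

The coefficient of `G = e^{bs} / ∏_j B(a_j s)` costs `O(d log² d)`. With `W = B'/B` one has `G'/G =
b - ∑_j a_j W(a_j s)`, which depends on the `a_j` only through power sums. These follow by Newton's
identities from `∏_j (1 - a_j X)`, which a product tree computes. The series `W`, the power sums and
`G` all satisfy recurrences of convolution type, solved by divide and conquer on top of FFT
multiplication (`Comp.mul_trunc`, `Comp.recurrence`, `Comp.coeff_cone`).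

Each form `⟨γ, v_ij⟩` is nonzero modulo `p`, so it vanishes for a fraction `1/p` of all `γ`, and a
random `γ` is bad with probability at most `Nd/p ≤ 1/c`. Hence about `c/(c - 1)` attempts suffice on
average. The tree has to be finite and always correct, so after `K` failures it searches the grid
`{0, …, Nd}^d`, which contains a good direction. The cost `M` of this search depends only on `N` and
`d`; it is reached with probability at most `c^{-K}`, and `K` is chosen to make `M / c^K ≤ 1`.

One program has to serve all rings and inputs. The straight-line part is therefore carried out in
the product of the rings of all admissible inputs, and a computation there is a single list of steps
valid in every factor (`Comp.realize`). -/

namespace LatticeCount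

/-! ### Straight-line computations -/

section Comp

variable {A : Type*} [CommRing A] {ω : ℕ → A}

/-- `Step ω X a`: the element `a` is obtained from elements of `X` by one arithmetic operation. -/
inductive Step (ω : ℕ → A) (X : Set A) : A → Prop
  | zero : Step ω X 0
  | one : Step ω X 1
  | root (k : ℕ) : Step ω X (ω k)
  | add {x y : A} (hx : x ∈ X) (hy : y ∈ X) : Step ω X (x + y)
  | sub {x y : A} (hx : x ∈ X) (hy : y ∈ X) : Step ω X (x - y)
  | mul {x y : A} (hx : x ∈ X) (hy : y ∈ X) : Step ω X (x * y)
  | inv {x y : A} (hx : x ∈ X) (hxy : x * y = 1) : Step ω X y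

theorem Step.mono {X X' : Set A} (hX : X ⊆ X') {a : A} (h : Step ω X a) : Step ω X' a := by
  cases h with
  | zero => exact .zero
  | one => exact .one
  | root k => exact .root k
  | add hx hy => exact .add (hX hx) (hX hy)
  | sub hx hy => exact .sub (hX hx) (hX hy)
  | mul hx hy => exact .mul (hX hx) (hX hy)
  | inv hx hxy => exact .inv (hX hx) hxy

/-- `Comp ω t X Y`: all elements of `Y` can be computed from `X` with at most `t` steps. -/
inductive Comp (ω : ℕ → A) : ℕ → Set A → Set A → Prop
  | done {t : ℕ} {X Y : Set A} (h : Y ⊆ X) : Comp ω t X Y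
  | step {t : ℕ} {X Y : Set A} {a : A} (h : Step ω X a) (hY : Comp ω t (insert a X) Y) :
      Comp ω (t + 1) X Y

namespace Comp

variable {s t : ℕ} {X X' Y Y' Z : Set A}

theorem mono_time (h : Comp ω s X Y) (hst : s ≤ t) : Comp ω t X Y := by
  induction h generalizing t with
  | done h => exact .done h
  | step h _ ih =>
    obtain ⟨t, rfl⟩ : ∃ t', t = t' + 1 := ⟨t - 1, by omega⟩
    exact .step h (ih (by omega))

theorem mono_left (h : Comp ω t X Y) (hX : X ⊆ X') : Comp ω t X' Y := by
  induction h generalizing X' with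
  | done h => exact .done (h.trans hX)
  | step h _ ih => exact .step (h.mono hX) (ih (Set.insert_subset_insert hX))

theorem mono_right (h : Comp ω t X Y) (hY : Y' ⊆ Y) : Comp ω t X Y' := by
  induction h with
  | done h => exact .done (hY.trans h)
  | step h _ ih => exact .step h (ih hY)

theorem bind (h : Comp ω s X Y) (h' : Comp ω t (X ∪ Y) Z) : Comp ω (s + t) X Z := by
  induction h with
  | done h => exact (h'.mono_left (by simp [h])).mono_time (by omega)
  | step h _ ih =>
    exact (Comp.step h (ih (h'.mono_left (Set.union_subset_union_left _
      (Set.subset_insert _ _))))).mono_time (by omega)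

theorem union (h : Comp ω s X Y) (h' : Comp ω t X Z) : Comp ω (s + t) X (Y ∪ Z) := by
  refine h.bind ?_
  have : Comp ω t (X ∪ Y) Z := h'.mono_left Set.subset_union_left
  generalize hW : X ∪ Y = W at this
  have hYW : Y ⊆ W := hW ▸ Set.subset_union_right
  clear hW h h'
  induction this with
  | done h => exact .done (Set.union_subset hYW h)
  | step h _ ih => exact .step h (ih (hYW.trans (Set.subset_insert _ _)))

/-- Add the results of a computation to the known elements. -/
theorem extend (h : Comp ω s X Y) (h' : ∀ X', X ⊆ X' → Y ⊆ X' → Comp ω t X' Z) :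
    Comp ω (s + t) X Z :=
  h.bind (h' _ Set.subset_union_left Set.subset_union_right)

theorem of_mem {x : A} (hx : x ∈ X) : Comp ω 0 X {x} := .done (by simpa using hx)

theorem of_step {x : A} (h : Step ω X x) : Comp ω 1 X {x} := .step h (.done (by simp))

theorem add {x y : A} (hx : Comp ω s X {x}) (hy : Comp ω t X {y}) :
    Comp ω (s + t + 1) X {x + y} :=
  (hx.union hy).extend fun _ _ h => of_step (.add (h (by simp)) (h (by simp)))

theorem sub {x y : A} (hx : Comp ω s X {x}) (hy : Comp ω t X {y}) :
    Comp ω (s + t + 1) X {x - y} :=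
  (hx.union hy).extend fun _ _ h => of_step (.sub (h (by simp)) (h (by simp)))

theorem mul {x y : A} (hx : Comp ω s X {x}) (hy : Comp ω t X {y}) :
    Comp ω (s + t + 1) X {x * y} :=
  (hx.union hy).extend fun _ _ h => of_step (.mul (h (by simp)) (h (by simp)))

theorem inv {x y : A} (hx : Comp ω s X {x}) (hxy : x * y = 1) : Comp ω (s + 1) X {y} :=
  hx.extend fun _ _ h => of_step (.inv (h (by simp)) hxy)

end Comp

/-- The set of the first `n` terms of a sequence. -/
def seg (f : ℕ → A) (n : ℕ) : Set A := f '' Set.Iio n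

omit [CommRing A] in
theorem seg_subset {f : ℕ → A} {n : ℕ} {X : Set A} : seg f n ⊆ X ↔ ∀ i < n, f i ∈ X := by
  simp [seg, Set.subset_def]

omit [CommRing A] in
theorem mem_seg {f : ℕ → A} {n i : ℕ} (h : i < n) : f i ∈ seg f n := ⟨i, h, rfl⟩

namespace Comp

variable {s t : ℕ} {X X' Y Y' Z : Set A}

/-- A sequence is computed term by term, where each term may use the preceding ones. -/
theorem seg_of_prev {f : ℕ → A} {n : ℕ} (h : ∀ i < n, Comp ω t (X ∪ seg f i) {f i}) :
    Comp ω (n * t) X (seg f n) := by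
  induction n with
  | zero => exact .done (by simp [seg])
  | succ n ih =>
    have h1 := ih fun i hi => h i (by omega)
    have h2 := h1.bind (Z := seg f n ∪ {f n}) (t := t) (by
      have := (Comp.done (ω := ω) (t := 0) (X := X ∪ seg f n) (Y := seg f n)
        Set.subset_union_right).union (h n (by omega))
      simpa using this)
    refine (h2.mono_time (by rw [Nat.succ_mul])).mono_right ?_
    rw [seg_subset]
    intro i hi
    rcases Nat.lt_succ_iff_lt_or_eq.mp hi with hi | rfl
    · exact Or.inl (mem_seg hi)
    · exact Or.inr rfl

theorem seg_of_forall {f : ℕ → A} {n : ℕ} (h : ∀ i < n, Comp ω t X {f i}) :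
    Comp ω (n * t) X (seg f n) :=
  seg_of_prev fun i hi => (h i hi).mono_left Set.subset_union_left

theorem sum {ι : Type*} {f : ι → A} (S : Finset ι) (h : ∀ i ∈ S, Comp ω t X {f i}) :
    Comp ω (S.card * (t + 1) + 1) X {∑ i ∈ S, f i} := by
  classical
  induction S using Finset.induction_on with
  | empty => simpa using of_step (Step.zero (ω := ω) (X := X))
  | insert i S hi ih =>
    rw [Finset.sum_insert hi, Finset.card_insert_of_notMem hi]
    exact ((h i (by simp)).add (ih fun j hj => h j (by simp [hj]))).mono_time
      (by ring_nf; omega)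

theorem prod {ι : Type*} {f : ι → A} (S : Finset ι) (h : ∀ i ∈ S, Comp ω t X {f i}) :
    Comp ω (S.card * (t + 1) + 1) X {∏ i ∈ S, f i} := by
  classical
  induction S using Finset.induction_on with
  | empty => simpa using of_step (Step.one (ω := ω) (X := X))
  | insert i S hi ih =>
    rw [Finset.prod_insert hi, Finset.card_insert_of_notMem hi]
    exact ((h i (by simp)).mul (ih fun j hj => h j (by simp [hj]))).mono_time
      (by ring_nf; omega)

end Comp

/-! ### Fast multiplication -/

open Polynomial in
/-- The polynomial of degree `< n` with coefficients `f 0, …, f (n - 1)`. -/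
noncomputable def toPoly (f : ℕ → A) (n : ℕ) : A[X] := ∑ i ∈ Finset.range n, C (f i) * X ^ i

open Polynomial in
theorem toPoly_add_mul (f g : ℕ → A) (r : A) (n : ℕ) :
    toPoly (fun i => f i + r * g i) n = toPoly f n + C r * toPoly g n := by
  simp only [toPoly, Finset.mul_sum, ← Finset.sum_add_distrib]
  refine Finset.sum_congr rfl fun i _ => ?_
  simp only [map_add, map_mul]; ring

open Polynomial in
theorem toPoly_double (f : ℕ → A) (m : ℕ) :
    toPoly f (m + m) = toPoly f m + X ^ m * toPoly (fun i => f (m + i)) m := by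
  simp only [toPoly, Finset.sum_range_add, Finset.mul_sum]
  congr 1
  refine Finset.sum_congr rfl fun i _ => ?_
  rw [pow_add]; ring

open Polynomial in
theorem toPoly_congr {f g : ℕ → A} {n : ℕ} (h : ∀ i < n, f i = g i) : toPoly f n = toPoly g n :=
  Finset.sum_congr rfl fun i hi => by rw [h i (Finset.mem_range.mp hi)]

open Polynomial in
theorem coeff_toPoly (f : ℕ → A) (n i : ℕ) : (toPoly f n).coeff i = if i < n then f i else 0 := by
  simp [toPoly, coeff_X_pow]

open Polynomial in
/-- Modulo `X ^ m - r` and `X ^ m + r` the product is known, hence also modulo `X ^ 2m - r ^ 2`. -/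
theorem dvd_of_dvd_halves {m : ℕ} {r rinv half : A} (hr : r * rinv = 1) (hh : 2 * half = 1)
    {f g h₀ h₁ : ℕ → A}
    (h0 : (X ^ m - C r) ∣ toPoly (fun i => f i + r * f (m + i)) m *
      toPoly (fun i => g i + r * g (m + i)) m - toPoly h₀ m)
    (h1 : (X ^ m - C (-r)) ∣ toPoly (fun i => f i + (-r) * f (m + i)) m *
      toPoly (fun i => g i + (-r) * g (m + i)) m - toPoly h₁ m) :
    (X ^ (m + m) - C (r ^ 2)) ∣ toPoly f (m + m) * toPoly g (m + m) -
      (toPoly (fun i => (h₀ i + h₁ i) * half) m +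
        X ^ m * toPoly (fun i => (h₀ i - h₁ i) * half * rinv) m) := by
  have e1 : toPoly (fun i => (h₀ i + h₁ i) * half) m
      = C half * (toPoly h₀ m + toPoly h₁ m) := by
    simp only [toPoly, Finset.mul_sum, ← Finset.sum_add_distrib]
    refine Finset.sum_congr rfl fun i _ => ?_
    simp only [map_add, map_mul]; ring
  have e2 : toPoly (fun i => (h₀ i - h₁ i) * half * rinv) m
      = C half * C rinv * (toPoly h₀ m - toPoly h₁ m) := by
    simp only [toPoly, Finset.mul_sum, ← Finset.sum_sub_distrib]
    refine Finset.sum_congr rfl fun i _ => ?_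
    simp only [map_sub, map_mul]; ring
  rw [toPoly_add_mul f, toPoly_add_mul g] at h0 h1
  rw [toPoly_double f, toPoly_double g, e1, e2, map_pow, pow_add]
  have hr' : (C r : A[X]) * C rinv = 1 := by rw [← C_mul, hr, C_1]
  have hh' : (2 : A[X]) * C half = 1 := by
    rw [show (2 : A[X]) = C 2 from (map_ofNat C 2).symm, ← C_mul, hh, C_1]
  simp only [map_neg] at h1
  generalize (C r : A[X]) = r at *
  generalize (C rinv : A[X]) = ri at *
  generalize (C half : A[X]) = hf at *
  generalize toPoly f m = f0 at *
  generalize toPoly g m = g0 at *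
  generalize toPoly (fun i => f (m + i)) m = f1 at *
  generalize toPoly (fun i => g (m + i)) m = g1 at *
  generalize toPoly h₀ m = k0 at *
  generalize toPoly h₁ m = k1 at *
  generalize (X ^ m : A[X]) = x at *
  obtain ⟨w₀, hw0⟩ := h0
  obtain ⟨w₁, hw1⟩ := h1
  -- The difference of the two moduli is `2r`, and `hf * ri` inverts it.
  have hcop : IsCoprime (x - r) (x + r) :=
    ⟨-(hf * ri), hf * ri, by linear_combination (2 * hf) * hr' + hh'⟩
  have hfac : x * x - r ^ 2 = (x - r) * (x + r) := by ring
  rw [hfac]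
  refine hcop.mul_dvd
    ⟨w₀ + f1 * (g0 + x * g1) + (f0 + r * f1) * g1 - hf * ri * (k0 - k1), ?_⟩
    ⟨w₁ + f1 * (g0 + x * g1) + (f0 - r * f1) * g1 - hf * ri * (k0 - k1), ?_⟩
  · linear_combination hw0 - (hf * (k0 - k1)) * hr' - k0 * hh'
  · linear_combination hw1 + (hf * (k0 - k1)) * hr' - k1 * hh'

open Polynomial in
/-- Multiplication modulo `X ^ n - c`, `n = 2 ^ k`, where `c` is a power of a primitive root. -/
theorem Comp.mul_mod {X : Set A} {z half : A} {K : ℕ} (hz : z ^ 2 ^ K = -1)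
    (hh : 2 * half = 1) (hhX : half ∈ X) (hzX : ∀ e, z ^ e ∈ X) (k : ℕ) (hk : k ≤ K + 1) (e : ℕ)
    (f g : ℕ → A) (hf : seg f (2 ^ k) ⊆ X) (hg : seg g (2 ^ k) ⊆ X) :
    ∃ h : ℕ → A, (Polynomial.X ^ 2 ^ k - C (z ^ (2 ^ k * e))) ∣
        toPoly f (2 ^ k) * toPoly g (2 ^ k) - toPoly h (2 ^ k) ∧
      Comp ω ((6 * k + 1) * 2 ^ k) X (seg h (2 ^ k)) := by
  induction k generalizing e f g X with
  | zero =>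
    rw [seg_subset] at hf hg
    refine ⟨fun i => f 0 * g 0, by simp [toPoly], ?_⟩
    refine (Comp.seg_of_forall (t := 1) fun i hi => ?_).mono_time (by simp)
    exact (Comp.of_mem (hf 0 (by simp))).mul (Comp.of_mem (hg 0 (by simp)))
  | succ k ih =>
    set m := 2 ^ k with hm
    have h2m : 2 ^ (k + 1) = m + m := by rw [pow_succ]; omega
    rw [h2m] at hf hg ⊢
    rw [seg_subset] at hf hg
    have hzz : z ^ (2 ^ K + 2 ^ K) = 1 := by rw [pow_add, hz]; ring
    set r := z ^ (m * e) with hr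
    -- Since `m * 2 ^ (K - k) = 2 ^ K`, the shift of the exponent multiplies by `z ^ 2 ^ K = -1`;
    -- both half-size moduli are again of the form required by the induction.
    have hneg : z ^ (m * (e + 2 ^ (K - k))) = -r := by
      rw [mul_add, pow_add, hm, ← pow_add 2, show k + (K - k) = K by omega, hz]
      simp [hr, hm]
    have hrinv : r * z ^ (m * e * (2 ^ K + 2 ^ K - 1)) = 1 := by
      rw [hr, ← pow_add, show m * e + m * e * (2 ^ K + 2 ^ K - 1) = (2 ^ K + 2 ^ K) * (m * e) by
        have : 0 < 2 ^ K := by positivity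
        obtain ⟨q, hq⟩ : ∃ q, 2 ^ K + 2 ^ K = q + 1 := ⟨2 ^ K + 2 ^ K - 1, by omega⟩
        rw [hq]; simp; ring, pow_mul, hzz, one_pow]
    set rinv := z ^ (m * e * (2 ^ K + 2 ^ K - 1)) with hrinv'
    have hc : z ^ ((m + m) * e) = r ^ 2 := by rw [hr, ← pow_mul]; ring_nf
    -- The butterfly: one product `r * u (m + i)` serves both reductions, so a factor costs `3m`.
    -- Two factors and `6m` steps of recombination make `12m = 6 * 2 ^ (k + 1)` per level.
    have half_step : ∀ (X' : Set A) (u : ℕ → A), X ⊆ X' → (∀ i < m + m, u i ∈ X) →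
        Comp ω (m * 3) X' (seg (fun i => u i + r * u (m + i)) m ∪
          seg (fun i => u i + (-r) * u (m + i)) m) := by
      intro X' u hX hu
      have h1 : Comp ω (m * 1) X' (seg (fun i => r * u (m + i)) m) :=
        Comp.seg_of_forall fun i hi =>
          (Comp.of_mem (hX (hzX _))).mul (Comp.of_mem (hX (hu _ (by omega))))
      refine (h1.extend (t := m * 1 + m * 1) fun X'' h2 h3 => ?_).mono_time (by omega)
      rw [seg_subset] at h3
      refine (Comp.seg_of_forall fun i hi => ?_).union (Comp.seg_of_forall fun i hi => ?_)
      · exact (Comp.of_mem (h2 (hX (hu i (by omega))))).add (Comp.of_mem (h3 i hi))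
      · rw [neg_mul, ← sub_eq_add_neg]
        exact (Comp.of_mem (h2 (hX (hu i (by omega))))).sub (Comp.of_mem (h3 i hi))
    -- the four reduced factors become available
    have hred := (half_step X f subset_rfl hf).union (half_step X g subset_rfl hg)
    set Y := (seg (fun i => f i + r * f (m + i)) m ∪ seg (fun i => f i + (-r) * f (m + i)) m) ∪
      (seg (fun i => g i + r * g (m + i)) m ∪ seg (fun i => g i + (-r) * g (m + i)) m) with hY
    obtain ⟨h₀, hd0, hc0⟩ := ih (X := X ∪ Y) (Or.inl hhX) (fun e => Or.inl (hzX e)) (by omega) e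
      (fun i => f i + r * f (m + i)) (fun i => g i + r * g (m + i))
      (fun x hx => by simp only [hY, Set.mem_union]; tauto)
      (fun x hx => by simp only [hY, Set.mem_union]; tauto)
    obtain ⟨h₁, hd1, hc1⟩ := ih (X := X ∪ Y) (Or.inl hhX) (fun e => Or.inl (hzX e)) (by omega)
      (e + 2 ^ (K - k))
      (fun i => f i + (-r) * f (m + i)) (fun i => g i + (-r) * g (m + i))
      (fun x hx => by simp only [hY, Set.mem_union]; tauto)
      (fun x hx => by simp only [hY, Set.mem_union]; tauto)
    rw [hneg] at hd1
    rw [← hr] at hd0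
    let h : ℕ → A := fun i =>
      if i < m then (h₀ i + h₁ i) * half else (h₀ (i - m) - h₁ (i - m)) * half * rinv
    refine ⟨h, ?_, ?_⟩
    · rw [hc, toPoly_double h]
      have e1 : toPoly h m = toPoly (fun i => (h₀ i + h₁ i) * half) m :=
        toPoly_congr fun i hi => by simp [h, hi]
      have e2 : toPoly (fun i => h (m + i)) m =
          toPoly (fun i => (h₀ i - h₁ i) * half * rinv) m :=
        toPoly_congr fun i hi => by simp [h]
      rw [e1, e2]
      exact dvd_of_dvd_halves hrinv hh hd0 hd1
    · have hfin : Comp ω ((m + m) * 3) ((X ∪ Y) ∪ (seg h₀ m ∪ seg h₁ m)) (seg h (m + m)) := by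
        generalize hW : (X ∪ Y) ∪ (seg h₀ m ∪ seg h₁ m) = W
        have w0 : ∀ i < m, h₀ i ∈ W := fun i hi => hW ▸ Or.inr (Or.inl (mem_seg hi))
        have w1 : ∀ i < m, h₁ i ∈ W := fun i hi => hW ▸ Or.inr (Or.inr (mem_seg hi))
        have wX : X ⊆ W := fun x hx => hW ▸ Or.inl (Or.inl hx)
        refine Comp.seg_of_forall fun i hi => ?_
        by_cases him : i < m
        · simp only [h, if_pos him]
          exact Comp.mono_time (((Comp.of_mem (w0 i him)).add
            (Comp.of_mem (w1 i him))).mul (Comp.of_mem (wX hhX))) (by omega)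
        · have him' : i - m < m := by omega
          simp only [h, if_neg him]
          exact (((Comp.of_mem (w0 _ him')).sub (Comp.of_mem (w1 _ him'))).mul
            (Comp.of_mem (wX hhX))).mul (Comp.of_mem (wX (hzX _)))
      refine (hred.bind ((hc0.union hc1).bind hfin)).mono_time ?_
      ring_nf; omega

/-- The first `n` coefficients of a power series. -/
def coeffs (F : PowerSeries A) (n : ℕ) : Set A := seg (fun i => PowerSeries.coeff i F) n

open Polynomial in
/-- Fast multiplication of truncated power series. -/
theorem Comp.mul_trunc {X : Set A} (k : ℕ) (hz : ω (k + 1) ^ 2 ^ k = -1) (h2 : IsUnit (2 : A))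
    {F G : PowerSeries A} (hF : coeffs F (2 ^ k) ⊆ X) (hG : coeffs G (2 ^ k) ⊆ X) :
    Comp ω (24 * (k + 1) * 2 ^ k) X (coeffs (F * G) (2 ^ k)) := by
  obtain ⟨half, hh⟩ := h2.exists_right_inv
  set z := ω (k + 1) with hzdef
  set m := 2 ^ k with hm
  have hmpos : 0 < m := by positivity
  have hzz : z ^ (m + m) = 1 := by rw [pow_add, hz]; ring
  rw [coeffs, seg_subset] at hF hG
  -- powers of the root of unity, one half and zero
  have hpow : Comp ω ((m + m) * 2) X (seg (fun e => z ^ e) (m + m)) := by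
    refine Comp.seg_of_prev fun i hi => ?_
    cases i with
    | zero => simpa using (Comp.of_step Step.one).mono_time (by omega)
    | succ i =>
      rw [pow_succ]
      exact (Comp.of_mem (Set.mem_union_right _
        (mem_seg (f := fun e => z ^ e) (Nat.lt_succ_self i)))).mul
        (Comp.of_step (.root (k + 1)))
  have hhalf : Comp ω 4 X {half} := by
    refine Comp.inv (x := 1 + 1) ((Comp.of_step Step.one).add (Comp.of_step Step.one)) ?_
    rw [one_add_one_eq_two, hh]
  have hpre := (hpow.union hhalf).union (Comp.of_step (Step.zero (ω := ω) (X := X)))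
  -- Padding with zeros to length `2m` keeps the product below degree `2m`, so that reduction modulo
  -- `X ^ 2m - 1` (the case `e = 0`) loses nothing.
  let f : ℕ → A := fun i => if i < m then PowerSeries.coeff i F else 0
  let g : ℕ → A := fun i => if i < m then PowerSeries.coeff i G else 0
  have h2m : 2 ^ (k + 1) = m + m := by rw [pow_succ]; omega
  have hzero : ∀ u : ℕ → A, (∀ i, m ≤ i → u i = 0) → toPoly u (m + m) = toPoly u m := by
    intro u hu
    rw [toPoly_double]
    simp [toPoly, hu]
  refine (hpre.extend (t := (6 * (k + 1) + 1) * 2 ^ (k + 1)) fun X' hX hY => ?_).mono_time ?_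
  · have hzX : ∀ e, z ^ e ∈ X' := fun e => by
      rw [← Nat.mod_add_div e (m + m), pow_add, pow_mul, hzz, one_pow, mul_one]
      exact hY (Or.inl (Or.inl (mem_seg (f := fun e => z ^ e) (Nat.mod_lt _ (by omega)))))
    have h0X : (0 : A) ∈ X' := hY (Or.inr rfl)
    obtain ⟨h, hd, hc⟩ := Comp.mul_mod (ω := ω) (X := X') hz hh (hY (Or.inl (Or.inr rfl))) hzX
      (k + 1) le_rfl 0 f g
      (seg_subset.mpr fun i _ => by
        by_cases hi : i < m
        · simpa [f, hi] using hX (hF i hi)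
        · simpa [f, hi] using h0X)
      (seg_subset.mpr fun i _ => by
        by_cases hi : i < m
        · simpa [g, hi] using hX (hG i hi)
        · simpa [g, hi] using h0X)
    refine hc.mono_right ?_
    rw [h2m, hzero f (fun i hi => by simp [f, Nat.not_lt.mpr hi]),
      hzero g (fun i hi => by simp [g, Nat.not_lt.mpr hi]), mul_zero, pow_zero] at hd
    have heq : toPoly f m * toPoly g m = toPoly h (m + m) := by
      rcases subsingleton_or_nontrivial A with hA | hA
      · exact Subsingleton.elim _ _
      rw [← sub_eq_zero]
      by_contra hne
      -- A monic polynomial of degree `2m` cannot divide a nonzero one of smaller degree.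
      refine (monic_X_pow_sub_C (1 : A) (by omega)).not_dvd_of_degree_lt hne ?_ hd
      rw [degree_X_pow_sub_C (by omega), Polynomial.degree_lt_iff_coeff_zero]
      intro i hi
      rw [coeff_sub, coeff_toPoly, if_neg (by omega), sub_zero, Polynomial.coeff_mul]
      refine Finset.sum_eq_zero fun x hx => ?_
      have := Finset.HasAntidiagonal.mem_antidiagonal.1 hx
      rw [coeff_toPoly, coeff_toPoly]
      by_cases h1 : x.1 < m
      · rw [if_neg (show ¬ x.2 < m by omega), mul_zero]
      · rw [if_neg h1, zero_mul]
    rw [coeffs, seg_subset]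
    intro i hi
    have : PowerSeries.coeff i (F * G) = h i := by
      have h1 := congrArg (fun q => Polynomial.coeff q i) heq
      simp only [coeff_toPoly, if_pos (show i < m + m by omega)] at h1
      rw [← h1, PowerSeries.coeff_mul, Polynomial.coeff_mul]
      refine Finset.sum_congr rfl fun x hx => ?_
      have := Finset.HasAntidiagonal.mem_antidiagonal.1 hx
      rw [coeff_toPoly, coeff_toPoly, if_pos (by omega), if_pos (by omega)]
      simp only [f, g]
      rw [if_pos (by omega), if_pos (by omega)]
    show PowerSeries.coeff i (F * G) ∈ _
    rw [this]
    exact mem_seg (by omega)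
  · rw [h2m]; ring_nf; omega

/-! ### Recurrences of convolution type -/

/-- The terms coming from the block `[l, l + m)` form one coefficient of a product of power series,
so a single fast multiplication delivers them for all `t`. -/
theorem conv_shift (c g : ℕ → A) (l m t : ℕ) :
    ∑ i ∈ Finset.range (l + m), c (l + m + t - i) * g i =
      ∑ i ∈ Finset.range l, c (l + m + t - i) * g i +
        PowerSeries.coeff (m + t)
          (PowerSeries.mk (fun i => if i < m then g (l + i) else 0) * PowerSeries.mk c) := by
  rw [Finset.sum_range_add, PowerSeries.coeff_mul, Finset.Nat.sum_antidiagonal_eq_sum_range_succ_mk]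
  congr 1
  simp only [PowerSeries.coeff_mk, ite_mul, zero_mul]
  rw [← Finset.sum_filter]
  refine Finset.sum_congr ?_ fun i _ => ?_
  · ext i; simp; omega
  · rw [mul_comm, show l + m + t - (l + i) = m + t - i by omega]

/-- Divide and conquer on the block `[l, l + 2 ^ k)`. By `ha` the contribution of all earlier terms
has been accumulated already. The left half is solved, one truncated product carries its influence
to the right half, and the right half is solved: two half-size problems and one multiplication,
whence the second logarithm. -/
theorem Comp.recurrence_aux (k : ℕ) (h2 : IsUnit (2 : A))
    (hω : ∀ j ≤ k, ω (j + 1) ^ 2 ^ j = -1) (c g lam a : ℕ → A) (l : ℕ) (X : Set A)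
    (h0 : (0 : A) ∈ X) (hc : ∀ i < 2 ^ k, c i ∈ X) (hlam : ∀ i < 2 ^ k, lam (l + i) ∈ X)
    (ha : ∀ i < 2 ^ k, a (l + i) + ∑ j ∈ Finset.range l, c (l + i - j) * g j ∈ X)
    (hg : ∀ i < 2 ^ k, g (l + i) =
      lam (l + i) * (a (l + i) + ∑ j ∈ Finset.range (l + i), c (l + i - j) * g j)) :
    Comp ω (40 * (k + 1) ^ 2 * 2 ^ k) X (seg (fun i => g (l + i)) (2 ^ k)) := by
  induction k generalizing l X with
  | zero =>
    refine (Comp.seg_of_forall (t := 1) fun i hi => ?_).mono_time (by simp)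
    obtain rfl : i = 0 := by simpa using hi
    rw [hg 0 (by simp)]
    have h1 := ha 0 (by simp)
    simp only [add_zero] at h1 ⊢
    exact (Comp.of_mem (hlam 0 (by simp))).mul (Comp.of_mem h1)
  | succ k ih =>
    set m := 2 ^ k with hm
    have h2m : 2 ^ (k + 1) = m + m := by rw [pow_succ]; omega
    rw [h2m] at hc hlam ha hg ⊢
    have hleft := ih (fun j hj => hω j (by omega)) l X h0 (fun i hi => hc i (by omega))
      (fun i hi => hlam i (by omega)) (fun i hi => ha i (by omega)) (fun i hi => hg i (by omega))
    have hall : Comp ω (40 * (k + 1) ^ 2 * m + (24 * (k + 2) * (m + m) + (m * 1 +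
        40 * (k + 1) ^ 2 * m))) X (seg (fun i => g (l + i)) m ∪ seg (fun i => g (l + m + i)) m) := by
      refine hleft.extend fun X₁ hX₁ hY₁ => ?_
      rw [seg_subset] at hY₁
      have hmul := Comp.mul_trunc (ω := ω) (X := X₁) (k + 1) (hω (k + 1) le_rfl) h2
        (F := PowerSeries.mk (fun i => if i < m then g (l + i) else 0)) (G := PowerSeries.mk c)
        (by
          rw [coeffs, seg_subset]
          intro i _
          simp only [PowerSeries.coeff_mk]
          split_ifs with h
          · exact hY₁ i h
          · exact hX₁ h0)
        (by
          rw [coeffs, seg_subset, h2m]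
          intro i hi
          simpa using hX₁ (hc i hi))
      rw [h2m] at hmul
      refine hmul.extend fun X₂ hX₂ hY₂ => ?_
      rw [coeffs, seg_subset] at hY₂
      have hsum : Comp ω (m * 1) X₂ (seg (fun t => a (l + m + t) +
          ∑ j ∈ Finset.range (l + m), c (l + m + t - j) * g j) m) := by
        refine Comp.seg_of_forall fun t ht => ?_
        rw [conv_shift c g l m t, ← add_assoc]
        refine (Comp.of_mem ?_).add (Comp.of_mem (hY₂ (m + t) (by omega)))
        have := ha (m + t) (by omega)
        rw [← add_assoc] at this
        exact hX₂ (hX₁ this)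
      refine hsum.extend fun X₃ hX₃ hY₃ => ?_
      rw [seg_subset] at hY₃
      have hX : X ⊆ X₃ := hX₁.trans (hX₂.trans hX₃)
      have hright := ih (fun j hj => hω j (by omega)) (l + m) X₃ (hX h0)
        (fun i hi => hX (hc i (by omega)))
        (fun i hi => by simpa only [add_assoc] using hX (hlam (m + i) (by omega)))
        (fun i hi => hY₃ i hi)
        (fun i hi => by simpa only [add_assoc] using hg (m + i) (by omega))
      exact ((Comp.done (t := 0) (seg_subset.mpr fun i hi => hX₃ (hX₂ (hY₁ i hi)))).union
        hright).mono_time (by omega)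
    refine (hall.mono_time ?_).mono_right ?_
    · ring_nf; nlinarith [Nat.zero_le (k * m), Nat.zero_le m]
    · rw [seg_subset]
      intro i hi
      by_cases him : i < m
      · exact Or.inl (mem_seg (f := fun i => g (l + i)) him)
      · refine Or.inr ⟨i - m, by simp; omega, ?_⟩
        simp only
        congr 1; omega

/-- A sequence with `g n = lam n * (a n + ∑_{i < n} c (n - i) * g i)` is computed in
quasi-linear time. -/
theorem Comp.recurrence (k : ℕ) (h2 : IsUnit (2 : A))
    (hω : ∀ j ≤ k, ω (j + 1) ^ 2 ^ j = -1) (c g lam a : ℕ → A) (X : Set A)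
    (h0 : (0 : A) ∈ X) (hc : seg c (2 ^ k) ⊆ X) (hlam : seg lam (2 ^ k) ⊆ X)
    (ha : seg a (2 ^ k) ⊆ X)
    (hg : ∀ n < 2 ^ k, g n = lam n * (a n + ∑ j ∈ Finset.range n, c (n - j) * g j)) :
    Comp ω (40 * (k + 1) ^ 2 * 2 ^ k) X (seg g (2 ^ k)) := by
  rw [seg_subset] at hc hlam ha
  simpa using Comp.recurrence_aux (ω := ω) k h2 hω c g lam a 0 X h0 hc (by simpa using hlam)
    (by simpa using ha) (by simpa using hg)

/-! ### Products of linear factors -/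

/-- `∏_{i < n} (1 - a_i X)`. -/
noncomputable def linProd (a : ℕ → A) (n : ℕ) : PowerSeries A :=
  ∏ i ∈ Finset.range n, (1 - PowerSeries.C (a i) * PowerSeries.X)

theorem coeff_mul_one_sub (F : PowerSeries A) (a : A) (i : ℕ) :
    PowerSeries.coeff i (F * (1 - PowerSeries.C a * PowerSeries.X)) =
      PowerSeries.coeff i F - if i = 0 then 0 else a * PowerSeries.coeff (i - 1) F := by
  rw [show F * (1 - PowerSeries.C a * PowerSeries.X) =
    F - PowerSeries.C a * (F * PowerSeries.X) by ring, map_sub, PowerSeries.coeff_C_mul]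
  cases i with
  | zero => simp
  | succ i => simp [PowerSeries.coeff_succ_mul_X]

theorem coeff_linProd_of_lt (a : ℕ → A) (n i : ℕ) (h : n < i) :
    PowerSeries.coeff i (linProd a n) = 0 := by
  induction n generalizing i with
  | zero => simp [linProd, PowerSeries.coeff_one, Nat.pos_iff_ne_zero.mp h]
  | succ n ih =>
    rw [linProd, Finset.prod_range_succ, ← linProd, coeff_mul_one_sub, ih i (by omega),
      ih (i - 1) (by omega)]
    simp

theorem linProd_add (a : ℕ → A) (m n : ℕ) :
    linProd a (m + n) = linProd a m * linProd (fun i => a (m + i)) n := by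
  simp only [linProd, Finset.prod_range_add]

/-- A product tree with one fast multiplication per node. The product has degree at most `2 ^ k`, so
the length `2 ^ (k + 1)` captures all coefficients, including the top one. -/
theorem Comp.coeffs_linProd (k : ℕ) (h2 : IsUnit (2 : A)) (hω : ∀ j ≤ k + 1, ω (j + 1) ^ 2 ^ j = -1)
    (a : ℕ → A) (X : Set A) (h0 : (0 : A) ∈ X) (h1 : (1 : A) ∈ X) (ha : seg a (2 ^ k) ⊆ X) :
    Comp ω (80 * (k + 1) ^ 2 * 2 ^ k) X (coeffs (linProd a (2 ^ k)) (2 ^ (k + 1))) := by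
  induction k generalizing a with
  | zero =>
    rw [seg_subset] at ha
    refine (Comp.seg_of_forall (t := 1) fun i hi => ?_).mono_time (by simp)
    have hi' : i = 0 ∨ i = 1 := by simp at hi; omega
    simp only [linProd, pow_zero, Finset.prod_range_one]
    rcases hi' with rfl | rfl
    · simpa using (Comp.of_mem h1).mono_time (by omega)
    · have : PowerSeries.coeff 1 (1 - PowerSeries.C (a 0) * PowerSeries.X) = 0 - a 0 := by
        simp [PowerSeries.coeff_one]
      rw [this]
      exact (Comp.of_mem h0).sub (Comp.of_mem (ha 0 (by simp)))
  | succ k ih =>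
    set m := 2 ^ k with hm
    have h2m : 2 ^ (k + 1) = m + m := by rw [pow_succ]; omega
    rw [h2m] at ih
    have h4m : 2 ^ (k + 1 + 1) = m + m + (m + m) := by rw [pow_succ]; omega
    rw [h2m, h4m]
    rw [h2m, seg_subset] at ha
    have hl := (ih (fun j hj => hω j (by omega)) a (seg_subset.mpr fun i hi => ha i (by omega)))
    have hr := (ih (fun j hj => hω j (by omega)) (fun i => a (m + i))
      (seg_subset.mpr fun i hi => ha (m + i) (by omega)))
    refine ((hl.union hr).extend (t := 24 * (k + 1 + 1 + 1) * (m + m + (m + m)))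
      fun X' hX hY => ?_).mono_time ?_
    · rw [linProd_add, ← h4m]
      refine Comp.mul_trunc (k + 1 + 1) (hω _ le_rfl) h2 ?_ ?_
      · rw [coeffs, seg_subset]
        intro i hi
        by_cases him : i < m + m
        · exact hY (Or.inl (mem_seg (f := fun i => PowerSeries.coeff i _) him))
        · rw [coeff_linProd_of_lt _ _ _ (by have : 0 < m := by positivity
                                            omega)]
          exact hX h0
      · rw [coeffs, seg_subset]
        intro i hi
        by_cases him : i < m + m
        · exact hY (Or.inr (mem_seg (f := fun i => PowerSeries.coeff i _) him))
        · rw [coeff_linProd_of_lt _ _ _ (by have : 0 < m := by positivity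
                                            omega)]
          exact hX h0
    · ring_nf; nlinarith [Nat.zero_le (k * m), Nat.zero_le m]

/-! ### Logarithmic derivatives -/

open PowerSeries in
/-- Newton's identities. -/
theorem derivative_linProd (a : ℕ → A) (n : ℕ) :
    derivative A (linProd a n) =
      linProd a n * mk (fun i => -∑ j ∈ Finset.range n, a j ^ (i + 1)) := by
  induction n with
  | zero =>
    have : (mk fun i => -∑ j ∈ Finset.range 0, a j ^ (i + 1)) = 0 := by ext; simp
    rw [this]; simp [linProd]
  | succ n ih =>
    have hmk : (mk fun i => -∑ j ∈ Finset.range (n + 1), a j ^ (i + 1)) =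
        (mk fun i => -∑ j ∈ Finset.range n, a j ^ (i + 1)) - mk fun i => a n ^ (i + 1) := by
      ext i
      simp [Finset.sum_range_succ]; ring
    have hgeom : (1 - C (a n) * X) * (mk fun i => a n ^ (i + 1)) = C (a n) := by
      rw [mul_comm]
      ext i
      rw [coeff_mul_one_sub, coeff_C]
      cases i with
      | zero => simp
      | succ i => simp; ring
    rw [linProd, Finset.prod_range_succ, ← linProd, Derivation.leibniz, ih, hmk]
    simp only [smul_eq_mul, map_sub, derivative_one, Derivation.leibniz, derivative_C, derivative_X]
    linear_combination (linProd a n) * hgeom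

open PowerSeries in
theorem derivative_rescale (a : A) (F : PowerSeries A) :
    derivative A (rescale a F) = C a * rescale a (derivative A F) := by
  ext n
  simp only [coeff_derivative, coeff_rescale, coeff_C_mul]
  ring

-- A logarithmic derivative turns products into sums. The `j`-th factor contributes `a_j W(a_j s)`,
-- with `i`-th coefficient `W_i a_j ^ (i + 1)`; only power sums of the `a_j` survive.
open PowerSeries in
theorem derivative_prod_rescale {B W : PowerSeries A} (h : derivative A B = B * W) (a : ℕ → A)
    (n : ℕ) : derivative A (∏ j ∈ Finset.range n, rescale (a j) B) =
      (∏ j ∈ Finset.range n, rescale (a j) B) *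
        mk (fun i => coeff i W * ∑ j ∈ Finset.range n, a j ^ (i + 1)) := by
  induction n with
  | zero =>
    have : (mk fun i => coeff i W * ∑ j ∈ Finset.range 0, a j ^ (i + 1)) = 0 := by ext; simp
    rw [this]; simp
  | succ n ih =>
    have hmk : (mk fun i => coeff i W * ∑ j ∈ Finset.range (n + 1), a j ^ (i + 1)) =
        (mk fun i => coeff i W * ∑ j ∈ Finset.range n, a j ^ (i + 1)) +
          C (a n) * rescale (a n) W := by
      ext i
      simp only [coeff_mk, Finset.sum_range_succ, map_add, coeff_C_mul, coeff_rescale]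
      ring
    rw [Finset.prod_range_succ, Derivation.leibniz, ih, hmk, derivative_rescale, h, map_mul]
    simp only [smul_eq_mul]
    ring

/-! ### Truncated exponentials -/

/-- The truncated exponential series `∑_{k ≤ d + 1} f_k b^k s^k`, where `f_k` stands for `1 / k!`. -/
noncomputable def expTrunc (f : ℕ → A) (d : ℕ) (b : A) : PowerSeries A :=
  PowerSeries.mk fun k => if k ≤ d + 1 then f k * b ^ k else 0

/-- The truncation `∑_{k ≤ d} f_{k + 1} s^k` of `(e^s - 1) / s`. -/
noncomputable def expQuot (f : ℕ → A) (d : ℕ) : PowerSeries A :=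
  PowerSeries.mk fun k => if k ≤ d then f (k + 1) else 0

/-- `f_k` behaves like `1 / k!` for `k ≤ d + 1`. -/
def IsInvFactorial (f : ℕ → A) (d : ℕ) : Prop :=
  f 0 = 1 ∧ ∀ k ≤ d, ((k + 1 : ℕ) : A) * f (k + 1) = f k

theorem IsInvFactorial.constantCoeff_expQuot {f : ℕ → A} {d : ℕ} (hf : IsInvFactorial f d) :
    PowerSeries.constantCoeff (expQuot f d) = 1 := by
  have := hf.2 0 (by omega)
  rw [hf.1] at this
  rw [← PowerSeries.coeff_zero_eq_constantCoeff_apply]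
  simpa [expQuot] using this

theorem isUnit_of_constantCoeff {F : PowerSeries A} (h : IsUnit (PowerSeries.constantCoeff F)) :
    IsUnit F := PowerSeries.isUnit_iff_constantCoeff.mpr h

theorem coeff_mul_range (F G : PowerSeries A) (n : ℕ) :
    PowerSeries.coeff n (F * G) = ∑ i ∈ Finset.range (n + 1),
      PowerSeries.coeff (n - i) F * PowerSeries.coeff i G := by
  rw [mul_comm, PowerSeries.coeff_mul, Finset.Nat.sum_antidiagonal_eq_sum_range_succ_mk]
  exact Finset.sum_congr rfl fun i _ => mul_comm _ _

-- This is `G' = (b - Z) G` read off at degree `n ≤ d`, where `Z` is the logarithmic derivative of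
-- the product. It makes `G` computable by a recurrence of convolution type, without dividing power
-- series.
open PowerSeries in
theorem coeff_succ_of_mul_prod {f : ℕ → A} {d : ℕ} (hf : IsInvFactorial f d) {W : PowerSeries A}
    (hW : derivative A (expQuot f d) = expQuot f d * W) (a : ℕ → A) (b : A) (m : ℕ)
    {G : PowerSeries A}
    (hG : G * ∏ j ∈ Finset.range m, rescale (a j) (expQuot f d) = expTrunc f d b) (n : ℕ)
    (hn : n ≤ d) :
    coeff (n + 1) G * ((n + 1 : ℕ) : A) = ∑ i ∈ Finset.range (n + 1),
      (coeff (n - i) W * (-∑ j ∈ Finset.range m, a j ^ (n - i + 1)) +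
        if n - i = 0 then b else 0) * coeff i G := by
  set U := ∏ j ∈ Finset.range m, rescale (a j) (expQuot f d) with hU
  set Z := mk (fun i => coeff i W * ∑ j ∈ Finset.range m, a j ^ (i + 1)) with hZ
  have hUunit : IsUnit U := by
    refine isUnit_of_constantCoeff ?_
    have : ∀ x, constantCoeff (rescale x (expQuot f d)) = 1 := fun x => by
      rw [← coeff_zero_eq_constantCoeff_apply, coeff_rescale, coeff_zero_eq_constantCoeff_apply,
        hf.constantCoeff_expQuot]
      simp
    simp [hU, this]
  -- The equation `E' = bE` is only affected by the truncation from degree `d + 1` on.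
  have hE : X ^ (d + 1) ∣ derivative A (expTrunc f d b) - C b * expTrunc f d b := by
    rw [X_pow_dvd_iff]
    intro k hk
    have := hf.2 k (by omega)
    simp only [map_sub, coeff_derivative, coeff_C_mul, expTrunc, coeff_mk]
    rw [if_pos (by omega), if_pos (by omega), ← this]
    push_cast; ring
  rw [← hG, Derivation.leibniz, derivative_prod_rescale hW] at hE
  have hE' : X ^ (d + 1) ∣ U * (derivative A G - (C b - Z) * G) := by
    convert hE using 1
    simp only [smul_eq_mul, ← hU, ← hZ]
    ring
  -- The product `U` has constant coefficient one and cancels.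
  rw [hUunit.dvd_mul_left, X_pow_dvd_iff] at hE'
  have h := hE' n (by omega)
  rw [map_sub, coeff_derivative, sub_eq_zero] at h
  push_cast
  rw [h, coeff_mul_range]
  refine Finset.sum_congr rfl fun i _ => ?_
  congr 1
  simp [hZ, coeff_C]
  ring

/-! ### The contribution of one cone -/

-- Four stages: the product tree, the power sums by Newton's identities, the logarithmic derivative
-- of `G`, and `G` itself. The tree costs `80`, each of the two recurrences `40`, and the linear
-- passes fit into the remaining `6` of the constant `166`.
open PowerSeries in
theorem Comp.coeff_cone (k d : ℕ) (hk : d < 2 ^ k) (h2 : IsUnit (2 : A))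
    (hω : ∀ j ≤ k + 1, ω (j + 1) ^ 2 ^ j = -1) {f : ℕ → A} (hf : IsInvFactorial f d)
    {W : PowerSeries A} (hW : derivative A (expQuot f d) = expQuot f d * W) (iv : ℕ → A)
    (hiv : ∀ n ≤ d, n ≠ 0 → (n : A) * iv n = 1) (a : ℕ → A) (b : A) (G : PowerSeries A)
    (hG : G * ∏ j ∈ Finset.range (2 ^ k), rescale (a j) (expQuot f d) = expTrunc f d b)
    (X : Set A) (h0 : (0 : A) ∈ X) (h1 : (1 : A) ∈ X) (hnX : seg (fun n => (n : A)) (2 ^ k + 1) ⊆ X)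
    (hivX : seg iv (d + 1) ⊆ X) (hWX : coeffs W (2 ^ k) ⊆ X) (haX : seg a (2 ^ k) ⊆ X)
    (hb : b ∈ X) : Comp ω (166 * (k + 1) ^ 2 * 2 ^ k) X {coeff d G} := by
  have hnX' := seg_subset.mp hnX
  have hivX' := seg_subset.mp hivX
  have hWX' := seg_subset.mp hWX
  set m := 2 ^ k with hm
  have h2m : 2 ^ (k + 1) = m + m := by rw [pow_succ]; omega
  have hmpos : 0 < m := by positivity
  set q : ℕ → A := fun n => -∑ j ∈ Finset.range m, a j ^ (n + 1) with hq
  set P := linProd a m with hP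
  have hP0 : coeff 0 P = 1 := by
    simp [hP, linProd]
  -- Newton's identity `P' = P q`, solved for `q n` by means of `P_0 = 1`.
  have hqrec : ∀ n, q n = 1 * (coeff (n + 1) P * ((n + 1 : ℕ) : A) +
      ∑ j ∈ Finset.range n, (0 - coeff (n - j) P) * q j) := by
    intro n
    have h := congrArg (coeff n) (derivative_linProd a m)
    rw [coeff_derivative, coeff_mul_range, Finset.sum_range_succ] at h
    simp only [Nat.sub_self, ← hP, hP0, coeff_mk, one_mul] at h
    push_cast
    rw [one_mul, h]
    simp only [zero_sub, neg_mul, Finset.sum_neg_distrib]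
    simp only [hq]
    ring
  let H : ℕ → A := fun n => coeff n W * q n + if n = 0 then b else 0
  -- The relation `n G_n = ∑_{j < n} H_{n - 1 - j} G_j` in the standard form: `c` is `H` shifted by
  -- one, `lam n` is `1 / n`, and `z` supplies the initial value `G_0 = 1`. Beyond `d` no inverses
  -- are provided, so the sequence is cut off by `lam n = 0`.
  let g : ℕ → A := fun n => if n ≤ d then coeff n G else 0
  let c : ℕ → A := fun n => if n = 0 then 0 else H (n - 1)
  let lam : ℕ → A := fun n => if n = 0 then 1 else if n ≤ d then iv n else 0
  let z : ℕ → A := fun n => if n = 0 then 1 else 0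
  have hgrec : ∀ n, g n = lam n * (z n + ∑ j ∈ Finset.range n, c (n - j) * g j) := by
    intro n
    cases n with
    | zero =>
      have h := congrArg constantCoeff hG
      have : ∀ x, constantCoeff (rescale x (expQuot f d)) = 1 := fun x => by
        rw [← coeff_zero_eq_constantCoeff_apply, coeff_rescale, coeff_zero_eq_constantCoeff_apply,
          hf.constantCoeff_expQuot]
        simp
      simp only [map_mul, map_prod, this, Finset.prod_const_one, mul_one] at h
      simp [g, lam, z, h, expTrunc, ← coeff_zero_eq_constantCoeff_apply, hf.1]
    | succ n =>
      by_cases hnd : n + 1 ≤ d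
      · have h := coeff_succ_of_mul_prod hf hW a b m hG n (by omega)
        have hi := hiv (n + 1) hnd (by omega)
        simp only [g, lam, z, if_pos hnd, if_neg (Nat.succ_ne_zero n), zero_add]
        have hs : ∑ j ∈ Finset.range (n + 1), c (n + 1 - j) * (if j ≤ d then coeff j G else 0) =
            coeff (n + 1) G * ((n + 1 : ℕ) : A) := by
          rw [h]
          refine Finset.sum_congr rfl fun i hi => ?_
          have := Finset.mem_range.mp hi
          rw [if_pos (by omega)]
          simp only [c, if_neg (show n + 1 - i ≠ 0 by omega), H]
          rw [show n + 1 - i - 1 = n - i by omega]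
        rw [hs]
        linear_combination -(coeff (n + 1) G) * hi
      · simp [g, lam, hnd]
  have t1 := Comp.coeffs_linProd (ω := ω) k h2 hω a X h0 h1 haX
  refine Comp.mono_time (t1.extend (t := (m * 1 + m * 1) + (40 * (k + 1) ^ 2 * m +
    (m * 2 + 40 * (k + 1) ^ 2 * m))) fun X₁ hX₁ hY₁ => ?_) ?_
  · rw [coeffs, seg_subset, h2m] at hY₁
    have t2 : Comp ω (m * 1) X₁ (seg (fun n => coeff (n + 1) P * ((n + 1 : ℕ) : A)) m) :=
      Comp.seg_of_forall fun i hi => (Comp.of_mem (hY₁ (i + 1) (by omega))).mul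
        (Comp.of_mem (hX₁ (hnX' (i + 1) (by omega))))
    have t3 : Comp ω (m * 1) X₁ (seg (fun n => 0 - coeff n P) m) :=
      Comp.seg_of_forall fun i hi => (Comp.of_mem (hX₁ h0)).sub
        (Comp.of_mem (hY₁ i (by omega)))
    refine (t2.union t3).extend fun X₂ hX₂ hY₂ => ?_
    have t4 := Comp.recurrence (ω := ω) k h2 (fun j hj => hω j (by omega))
      (fun n => 0 - coeff n P) q (fun _ => 1) (fun n => coeff (n + 1) P * ((n + 1 : ℕ) : A)) X₂
      (hX₂ (hX₁ h0)) (Set.subset_union_right.trans hY₂)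
      (seg_subset.mpr fun i _ => hX₂ (hX₁ h1)) (Set.subset_union_left.trans hY₂)
      (fun n _ => hqrec n)
    refine t4.extend fun X₃ hX₃ hY₃ => ?_
    rw [seg_subset] at hY₃
    have hX : X ⊆ X₃ := hX₁.trans (hX₂.trans hX₃)
    have t5 : Comp ω (m * 2) X₃ (seg H m) := Comp.seg_of_forall fun i hi => by
      have hmul := (Comp.of_mem (ω := ω) (hX (hWX' i hi))).mul (Comp.of_mem (hY₃ i hi))
      refine hmul.add (Comp.of_mem ?_)
      split_ifs
      · exact hX hb
      · exact hX h0
    refine t5.extend fun X₄ hX₄ hY₄ => ?_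
    rw [seg_subset] at hY₄
    have hXX : X ⊆ X₄ := hX.trans hX₄
    have t6 := Comp.recurrence (ω := ω) k h2 (fun j hj => hω j (by omega)) c g lam z X₄ (hXX h0)
      (seg_subset.mpr fun i hi => by
        simp only [c]
        split_ifs
        · exact hXX h0
        · exact hY₄ _ (by omega))
      (seg_subset.mpr fun i hi => by
        simp only [lam]
        split_ifs with h h'
        · exact hXX h1
        · exact hXX (hivX' i (by omega))
        · exact hXX h0)
      (seg_subset.mpr fun i hi => by
        simp only [z]
        split_ifs
        · exact hXX h1
        · exact hXX h0) (fun n _ => hgrec n)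
    refine t6.mono_right ?_
    rw [Set.singleton_subset_iff]
    exact ⟨d, hk, by simp [g]⟩
  · ring_nf; nlinarith [Nat.zero_le (k * m), Nat.zero_le m]

open PowerSeries in
/-- The straight-line part of the counting algorithm. -/
theorem Comp.sum_cones {N d : ℕ} (k : ℕ) (hd : 1 ≤ d) (hk : d < 2 ^ k)
    (hω : ∀ j ≤ k + 1, ω (j + 1) ^ 2 ^ j = -1)
    (hunit : ∀ n : ℕ, 1 ≤ n → n ≤ d + 1 → IsUnit (n : A))
    (a : Fin N → Fin d → A) (b s : Fin N → A) (ha : ∀ i j, IsUnit (a i j)) (X : Set A)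
    (haX : ∀ i j, a i j ∈ X) (hbX : ∀ i, b i ∈ X) (hsX : ∀ i, s i ∈ X) :
    ∃ (f : ℕ → A) (G : Fin N → PowerSeries A) (c : Fin N → A), IsInvFactorial f d ∧
      (∀ i, G i * ∏ j, rescale (a i j) (expQuot f d) = expTrunc f d (b i)) ∧
      (∀ i, c i * ∏ j, (-a i j) = 1) ∧
      Comp ω (230 * (N + 1) * (k + 1) ^ 2 * 2 ^ k) X {∑ i, s i * (c i * coeff d (G i))} := by
  have h2 : IsUnit (2 : A) := by simpa using hunit 2 (by omega) (by omega)
  -- The value `0` outside `1, …, d + 1` keeps the whole segment of length `2 ^ k + 1` computable.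
  have hinv : ∀ n : ℕ, ∃ y : A, (1 ≤ n → n ≤ d + 1 → (n : A) * y = 1) ∧ (n = 0 → y = 0) ∧
      (d + 1 < n → y = 0) := by
    intro n
    by_cases h : 1 ≤ n ∧ n ≤ d + 1
    · obtain ⟨y, hy⟩ := (hunit n h.1 h.2).exists_right_inv
      exact ⟨y, fun _ _ => hy, by omega, by omega⟩
    · exact ⟨0, by tauto, by simp, by simp⟩
  choose iv hiv hiv0 hiv1 using hinv
  let f : ℕ → A := fun n => ∏ i ∈ Finset.range n, iv (i + 1)
  have hf : IsInvFactorial f d := by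
    refine ⟨by simp [f], fun k hk => ?_⟩
    simp only [f, Finset.prod_range_succ]
    linear_combination (∏ i ∈ Finset.range k, iv (i + 1)) * hiv (k + 1) (by omega) (by omega)
  set B := expQuot f d with hB
  have hBunit : IsUnit B := isUnit_of_constantCoeff (by simp [hB, hf.constantCoeff_expQuot])
  obtain ⟨Binv, hBinv⟩ := hBunit.exists_right_inv
  set W := Binv * derivative A B with hWdef
  have hW : derivative A B = B * W := by
    rw [hWdef, ← mul_assoc, hBinv, one_mul]
  -- Padding the exponents with zeros up to `2 ^ k` is harmless: rescaling `B` by `0` gives the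
  -- factor `1`.
  let a' : Fin N → ℕ → A := fun i j => if h : j < d then a i ⟨j, h⟩ else 0
  set m := 2 ^ k with hm
  have hU : ∀ i, ∏ j ∈ Finset.range m, rescale (a' i j) B = ∏ j, rescale (a i j) B := by
    intro i
    rw [← Fin.prod_univ_eq_prod_range (fun j => rescale (a' i j) B) m,
      Fin.prod_univ_eq_prod_range (fun j => rescale (a' i j) B) m,
      ← Finset.prod_subset (Finset.range_subset_range.mpr hk.le)]
    · rw [Finset.prod_range]
      exact Finset.prod_congr rfl fun j _ => by simp [a']
    · intro j _ hj
      have : ¬ j < d := by simpa using hj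
      simp [a', this, hB, hf.constantCoeff_expQuot]
  have hG : ∀ i, ∃ G, G * ∏ j, rescale (a i j) B = expTrunc f d (b i) := by
    intro i
    have : IsUnit (∏ j, rescale (a i j) B) := by
      rw [IsUnit.prod_univ_iff]
      exact fun j => hBunit.map _
    obtain ⟨V, hV⟩ := this.exists_left_inv
    exact ⟨expTrunc f d (b i) * V, by rw [mul_assoc, hV, mul_one]⟩
  choose G hG using hG
  have hc : ∀ i, ∃ c, c * ∏ j, (-a i j) = 1 := by
    intro i
    have : IsUnit (∏ j, (-a i j)) := by
      rw [IsUnit.prod_univ_iff]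
      exact fun j => (ha i j).neg
    exact this.exists_left_inv
  choose c hc using hc
  refine ⟨f, G, c, hf, hG, hc, ?_⟩
  have hB0 : coeff 0 B = 1 := by
    rw [coeff_zero_eq_constantCoeff_apply, hB, hf.constantCoeff_expQuot]
  have hWrec : ∀ n, coeff n W = 1 * (coeff (n + 1) B * ((n + 1 : ℕ) : A) +
      ∑ j ∈ Finset.range n, (0 - coeff (n - j) B) * coeff j W) := by
    intro n
    have h := congrArg (coeff n) hW
    rw [coeff_derivative, coeff_mul_range, Finset.sum_range_succ] at h
    simp only [Nat.sub_self, hB0, one_mul] at h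
    push_cast
    rw [one_mul, h]
    simp only [zero_sub, neg_mul, Finset.sum_neg_distrib]
    ring
  -- constants
  have t0 : Comp ω (1 + 1) X ({0} ∪ {1}) := (Comp.of_step .zero).union (Comp.of_step .one)
  have hsmall : 2 ≤ m := by omega
  refine Comp.mono_time (t0.extend (t := (m + 1) * 1 + ((m + 1) * 1 + (m * 1 + ((m * 1 + m * 1) +
    (40 * (k + 1) ^ 2 * m + (N * ((166 * (k + 1) ^ 2 * m + (d * 2 + 2) + 2) + 1) + 1))))))
    fun X₀ hX₀ hY₀ => ?_) ?_
  · have h0 : (0 : A) ∈ X₀ := hY₀ (by simp)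
    have h1 : (1 : A) ∈ X₀ := hY₀ (by simp)
    have t1 : Comp ω ((m + 1) * 1) X₀ (seg (fun n => (n : A)) (m + 1)) := by
      refine Comp.seg_of_prev fun i hi => ?_
      cases i with
      | zero =>
        rw [Nat.cast_zero]
        exact (Comp.of_mem (Set.mem_union_left _ h0)).mono_time (Nat.zero_le 1)
      | succ i =>
        rw [Nat.cast_succ]
        exact (Comp.of_mem (Set.mem_union_right _ (mem_seg (f := fun n : ℕ => (n : A))
          (Nat.lt_succ_self i)))).add (Comp.of_mem (Set.mem_union_left _ h1))
    refine t1.extend fun X₁ hX₁ hN => ?_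
    have hN' := seg_subset.mp hN
    have t2 : Comp ω ((m + 1) * 1) X₁ (seg iv (m + 1)) := by
      refine Comp.seg_of_forall fun i hi => ?_
      by_cases hi0 : i = 0
      · rw [hiv0 i hi0]
        exact (Comp.of_mem (hX₁ h0)).mono_time (by omega)
      by_cases hid : i ≤ d + 1
      · exact (Comp.of_mem (hN' i (by omega))).inv (hiv i (by omega) hid)
      · rw [hiv1 i (by omega)]
        exact (Comp.of_mem (hX₁ h0)).mono_time (by omega)
    refine t2.extend fun X₂ hX₂ hI => ?_
    have t3 : Comp ω (m * 1) X₂ (seg (fun n => f (n + 1)) m) := by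
      refine Comp.seg_of_prev fun i hi => ?_
      have hI' := seg_subset.mp hI
      have hf' : f (i + 1) = f i * iv (i + 1) := Finset.prod_range_succ _ _
      rw [hf']
      cases i with
      | zero => 
        exact (Comp.of_mem (Set.mem_union_left _ (by simpa [f] using hX₂ (hX₁ h1)))).mul
          (Comp.of_mem (Set.mem_union_left _ (hI' _ (by omega))))
      | succ i =>
        exact (Comp.of_mem (Set.mem_union_right _ (mem_seg (f := fun n => f (n + 1)) (Nat.lt_succ_self i)))).mul
          (Comp.of_mem (Set.mem_union_left _ (hI' _ (by omega))))
    refine t3.extend fun X₃ hX₃ hF => ?_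
    rw [seg_subset] at hF
    have hX03 : X₀ ⊆ X₃ := hX₁.trans (hX₂.trans hX₃)
    have hBX : ∀ n, coeff n B ∈ X₃ := by
      intro n
      simp only [hB, expQuot, coeff_mk]
      split_ifs with h
      · exact hF n (by omega)
      · exact hX03 h0
    have t4 : Comp ω (m * 1) X₃ (seg (fun n => coeff (n + 1) B * ((n + 1 : ℕ) : A)) m) :=
      Comp.seg_of_forall fun i hi => (Comp.of_mem (hBX _)).mul
        (Comp.of_mem (hX₃ (hX₂ (hN' (i + 1) (by omega)))))
    have t5 : Comp ω (m * 1) X₃ (seg (fun n => 0 - coeff n B) m) :=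
      Comp.seg_of_forall fun i hi => (Comp.of_mem (hX03 h0)).sub (Comp.of_mem (hBX _))
    refine (t4.union t5).extend fun X₄ hX₄ hY₄ => ?_
    have t6 := Comp.recurrence (ω := ω) k h2 (fun j hj => hω j (by omega))
      (fun n => 0 - coeff n B) (fun n => coeff n W) (fun _ => 1)
      (fun n => coeff (n + 1) B * ((n + 1 : ℕ) : A)) X₄ (hX₄ (hX03 h0))
      (Set.subset_union_right.trans hY₄) (seg_subset.mpr fun i _ => hX₄ (hX03 h1))
      (Set.subset_union_left.trans hY₄) (fun n _ => hWrec n)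
    refine t6.extend fun X₅ hX₅ hW₅ => ?_
    have hX05 : X₀ ⊆ X₅ := hX03.trans (hX₄.trans hX₅)
    have hX : X ⊆ X₅ := hX₀.trans hX05
    refine Comp.mono_time (Comp.sum (t := 166 * (k + 1) ^ 2 * m + (d * 2 + 2) + 2)
      Finset.univ fun i _ => ?_) (by simp)
    have t7 := Comp.coeff_cone (ω := ω) k d hk h2 hω hf hW iv
      (fun n hn hn0 => hiv n (by omega) (by omega)) (a' i) (b i) (G i) (by rw [hU]; exact hG i)
      X₅ (hX05 h0) (hX05 h1) (hN.trans (hX₂.trans (hX₃.trans (hX₄.trans hX₅))))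
      (seg_subset.mpr fun n hn => hX₅ (hX₄ (hX₃ (seg_subset.mp hI n (by omega))))) hW₅
      (seg_subset.mpr fun j _ => by
        simp only [a']
        split_ifs
        · exact hX (haX _ _)
        · exact hX05 h0) (hX (hbX i))
    rw [← hm] at t7
    have t8 : Comp ω (d * (1 + 1) + 1) X₅ {∏ j, (-a i j)} :=
      Comp.mono_time (Comp.prod (t := 1) Finset.univ fun j _ => by
        rw [← zero_sub]
        exact (Comp.of_mem (hX05 h0)).sub (Comp.of_mem (hX (haX i j)))) (by simp)
    have t9 : Comp ω (d * (1 + 1) + 1 + 1) X₅ {c i} := t8.inv (by rw [mul_comm]; exact hc i)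
    exact ((Comp.of_mem (hX (hsX i))).mul (t9.mul t7)).mono_time (by omega)
  · have hm' : d * N ≤ m * N := Nat.mul_le_mul_right _ hk.le
    have hN2 : 2 * N ≤ m * N := Nat.mul_le_mul_right _ hsmall
    have hx : 1 ≤ (k + 1) ^ 2 := Nat.one_le_pow _ _ (by omega)
    generalize (k + 1) ^ 2 = x at *
    have h3 : m * N ≤ x * (m * N) := Nat.le_mul_of_pos_left _ hx
    have h4 : m ≤ x * m := Nat.le_mul_of_pos_left _ hx
    ring_nf at h3 h4 hm' hN2 ⊢
    omega

end Comp

/-! ### From rational functions to power series -/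

section Lattice

theorem finite_latticePoints {d : ℕ} {P : Set (Fin d → ℝ)} (hP : IsRationalPolytope P) :
    (latticePoints P).Finite := by
  obtain ⟨V, rfl⟩ := hP
  have hb : Bornology.IsBounded (convexHull ℝ
      ((fun (q : Fin d → ℚ) (k : Fin d) => ((q k : ℚ) : ℝ)) '' (V : Set (Fin d → ℚ)))) :=
    isBounded_convexHull.mpr (V.finite_toSet.image _).isBounded
  obtain ⟨M, hM⟩ := hb.exists_norm_le
  refine (Set.finite_Icc (fun _ : Fin d => -⌈M⌉) (fun _ => ⌈M⌉)).subset fun α hα => ?_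
  have h : ∀ k, |(α k : ℝ)| ≤ ⌈M⌉ := fun k =>
    ((norm_le_pi_norm (fun k => (α k : ℝ)) k).trans (hM _ hα)).trans (Int.le_ceil M)
  refine ⟨fun k => ?_, fun k => ?_⟩
  · have := (abs_le.mp (h k)).1
    exact_mod_cast this
  · have := (abs_le.mp (h k)).2
    exact_mod_cast this

theorem mono_zero {d : ℕ} : mono (0 : Fin d → ℤ) = 1 := by simp [mono]

theorem mono_add {d : ℕ} (α β : Fin d → ℤ) : mono (α + β) = mono α * mono β := by
  simp only [mono, ← Finset.prod_mul_distrib]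
  refine Finset.prod_congr rfl fun k _ => zpow_add₀ ?_ _ _
  rw [Ne, map_eq_zero_iff _ (IsFractionRing.injective _ _)]
  exact MvPolynomial.X_ne_zero k

/-- The monomials as a homomorphism. -/
noncomputable def monoHom (d : ℕ) : Multiplicative (Fin d → ℤ) →* RatFun d where
  toFun α := mono α.toAdd
  map_one' := mono_zero
  map_mul' _ _ := mono_add _ _

theorem mono_natCast {d : ℕ} (β : Fin d →₀ ℕ) : mono (fun k => (β k : ℤ)) =
    algebraMap (MvPolynomial (Fin d) ℚ) (RatFun d) (MvPolynomial.monomial β 1) := by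
  rw [MvPolynomial.monomial_eq, map_mul, map_one, map_one, one_mul, Finsupp.prod_fintype _ _
    (by simp), map_prod]
  simp [mono]

/-- Multiplication by one large monomial makes all exponents in a finite relation nonnegative, and
distinct monomials of a polynomial ring are independent. -/
theorem linearIndependent_mono (d : ℕ) : LinearIndependent ℤ (mono (d := d)) := by
  rw [linearIndependent_iff']
  intro s c hs α hα
  classical
  obtain ⟨β, hβ⟩ : ∃ β : Fin d → ℕ, ∀ α ∈ s, ∀ k, 0 ≤ α k + β k := by
    refine ⟨fun k => ∑ α ∈ s, (α k).natAbs, fun α hα k => ?_⟩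
    have h3 : |α k| ≤ ∑ α ∈ s, |α k| :=
      Finset.single_le_sum (f := fun α : Fin d → ℤ => |α k|) (fun _ _ => abs_nonneg _) hα
    have := neg_abs_le (α k)
    push_cast
    linarith
  let sh : (Fin d → ℤ) → (Fin d →₀ ℕ) := fun α =>
    Finsupp.equivFunOnFinite.symm fun k => (α k + β k).toNat
  have hsh : ∀ α ∈ s, mono α * mono (fun k => (β k : ℤ)) =
      algebraMap (MvPolynomial (Fin d) ℚ) (RatFun d) (MvPolynomial.monomial (sh α) 1) := by
    intro α hα
    rw [← mono_add, ← mono_natCast]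
    congr 1
    ext k
    simp [sh, Int.toNat_of_nonneg (hβ α hα k)]
  have hinj : ∀ α' ∈ s, sh α' = sh α → α' = α := by
    intro α' hα' h
    ext k
    have h1 := DFunLike.congr_fun h k
    have h2 := hβ α hα k
    have h3 := hβ α' hα' k
    simp only [sh, Finsupp.equivFunOnFinite_symm_apply_apply] at h1
    omega
  have h0 : algebraMap (MvPolynomial (Fin d) ℚ) (RatFun d)
      (∑ α ∈ s, MvPolynomial.monomial (sh α) (c α : ℚ)) = 0 := by
    rw [map_sum, ← zero_mul (mono (fun k => (β k : ℤ))), ← hs, Finset.sum_mul]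
    refine Finset.sum_congr rfl fun α hα => ?_
    rw [smul_mul_assoc, hsh α hα, ← map_zsmul, zsmul_eq_mul, ← map_intCast (MvPolynomial.C (R := ℚ) (σ := Fin d)),
      MvPolynomial.C_mul_monomial, mul_one]
  rw [map_eq_zero_iff _ (IsFractionRing.injective _ _)] at h0
  have h := congrArg (MvPolynomial.coeff (sh α)) h0
  rw [MvPolynomial.coeff_sum, Finset.sum_eq_single α] at h
  · simpa [MvPolynomial.coeff_monomial] using h
  · intro α' hα' hne
    have hne' : sh α' ≠ sh α := fun h => hne (hinj α' hα' h)
    simp [MvPolynomial.coeff_monomial, hne']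
  · exact fun h => (h hα).elim

/-- The ring of integer Laurent polynomials. -/
abbrev Laurent (d : ℕ) : Type := AddMonoidAlgebra ℤ (Fin d → ℤ)

noncomputable def toRatFun (d : ℕ) : Laurent d →+* RatFun d :=
  (AddMonoidAlgebra.lift ℤ (RatFun d) (Fin d → ℤ) (monoHom d)).toRingHom

/-- The Laurent monomial `y^α`. -/
noncomputable def lmono {d : ℕ} (α : Fin d → ℤ) : Laurent d := AddMonoidAlgebra.single α 1

theorem toRatFun_lmono {d : ℕ} (α : Fin d → ℤ) : toRatFun d (lmono α) = mono α := by
  simp [toRatFun, lmono, monoHom]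

/-- Injectivity brings an identity of rational functions over `ℚ` down to integer coefficients,
where it can be mapped to characteristic `p`. -/
theorem toRatFun_injective (d : ℕ) : Function.Injective (toRatFun d) := by
  rw [injective_iff_map_eq_zero]
  intro x hx
  have h := linearIndependent_mono d
  rw [linearIndependent_iff'] at h
  have hx' : ∑ α ∈ x.coeff.support, x.coeff α • mono α = 0 := by
    rw [← hx]
    simp [toRatFun, AddMonoidAlgebra.lift_apply, Finsupp.sum, monoHom]
  ext α
  by_cases hα : α ∈ x.coeff.support
  · simpa using h _ _ hx' α hα
  · simpa using hα

theorem mono_injective {d : ℕ} : Function.Injective (mono (d := d)) :=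
  (linearIndependent_mono d).injective

/-- The identity between `f(P; y)` and the short sum, after clearing denominators. -/
theorem ShortSum.Represents.laurent {N d : ℕ} {S : ShortSum N d} {P : Set (Fin d → ℝ)}
    (hS : S.Represents P) (hP : (latticePoints P).Finite) :
    (∑ α ∈ hP.toFinset, lmono α) * ∏ i, ∏ j, (1 - lmono (S.v i j)) =
      ∑ i, (((S.sign i : ℤˣ) : ℤ) : Laurent d) * (lmono (S.u i) *
        ∏ i' ∈ Finset.univ.erase i, ∏ j, (1 - lmono (S.v i' j))) := by
  apply toRatFun_injective d
  have hne : ∀ i, ∏ j, (1 - mono (S.v i j)) ≠ 0 := by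
    intro i
    rw [Finset.prod_ne_zero_iff]
    intro j _ h
    refine hS.1 i j (mono_injective ?_)
    rw [mono_zero, ← sub_eq_zero.mp h]
  have h := hS.2
  rw [genFun, finsum_mem_eq_finite_toFinset_sum _ hP, ShortSum.toRatFun] at h
  simp only [map_mul, map_sum, map_prod, map_sub, map_one, toRatFun_lmono, map_intCast]
  rw [h, Finset.sum_mul]
  refine Finset.sum_congr rfl fun i _ => ?_
  rw [← Finset.mul_prod_erase Finset.univ (fun i => ∏ j, (1 - mono (S.v i j)))
    (Finset.mem_univ i)]
  have := hne i
  field_simp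

/-- A choice of units `w^⟨γ, α⟩` turns the identity into one in an arbitrary ring. -/
theorem ShortSum.Represents.map {N d : ℕ} {S : ShortSum N d} {P : Set (Fin d → ℝ)}
    (hS : S.Represents P) (hP : (latticePoints P).Finite) {A : Type*} [CommRing A] (w : Aˣ)
    (γ : Fin d → ℤ) :
    (∑ α ∈ hP.toFinset, ((w ^ (∑ k, γ k * α k) : Aˣ) : A)) *
        ∏ i, ∏ j, (1 - ((w ^ (∑ k, γ k * S.v i j k) : Aˣ) : A)) =
      ∑ i, (((S.sign i : ℤˣ) : ℤ) : A) * (((w ^ (∑ k, γ k * S.u i k) : Aˣ) : A) *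
        ∏ i' ∈ Finset.univ.erase i, ∏ j, (1 - ((w ^ (∑ k, γ k * S.v i' j k) : Aˣ) : A))) := by
  let F : Multiplicative (Fin d → ℤ) →* A :=
    { toFun := fun α => ((w ^ (∑ k, γ k * α.toAdd k) : Aˣ) : A)
      map_one' := by simp
      map_mul' := fun α β => by
        rw [← Units.val_mul, ← zpow_add, ← Finset.sum_add_distrib]
        simp [mul_add] }
  let φ : Laurent d →+* A := (AddMonoidAlgebra.lift ℤ A (Fin d → ℤ) F).toRingHom
  have hφ : ∀ α, φ (lmono α) = ((w ^ (∑ k, γ k * α k) : Aˣ) : A) := by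
    intro α
    simp [φ, lmono, F]
  have h := congrArg φ (hS.laurent hP)
  simpa only [map_mul, map_sum, map_prod, map_sub, map_one, hφ, map_intCast] using h

/-- Without terms there are no lattice points. -/
theorem natCast_ncard_of_isEmpty {d : ℕ} {S : ShortSum 0 d} {P : Set (Fin d → ℝ)}
    (hS : S.Represents P) (hP : (latticePoints P).Finite) (R : Type*) [CommRing R] :
    ((latticePoints P).ncard : R) = 0 := by
  have h := hS.map hP (1 : Rˣ) 0
  simpa [Set.ncard_eq_toFinset_card _ hP] using h

/-- A single cone does not represent a polytope. -/
theorem not_represents_one {d : ℕ} (hd : 1 ≤ d) {S : ShortSum 1 d} {P : Set (Fin d → ℝ)}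
    (hP : (latticePoints P).Finite) : ¬ S.Represents P := by
  intro hS
  -- At `y = 1` every factor `1 - y^v` vanishes, but the product over the other cones on the right
  -- is empty: `0 = ±1`.
  have h := hS.map hP (1 : ℤˣ) 0
  have hd0 : d ≠ 0 := by omega
  have : (0 : ℤ) = ((S.sign 0 : ℤˣ) : ℤ) := by simpa [hd0] using h
  exact (S.sign 0).ne_zero this.symm

end Lattice

/-! ### The lattice point count as a coefficient of truncated exponential series -/

section Formula

variable {R : Type*} [CommRing R] {f : ℕ → R} {d : ℕ}

theorem IsInvFactorial.factorial_mul (hf : IsInvFactorial f d) (k : ℕ) (hk : k ≤ d + 1) :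
    (k.factorial : R) * f k = 1 := by
  induction k with
  | zero => simp [hf.1]
  | succ k ih =>
    rw [Nat.factorial_succ, ← ih (by omega), ← hf.2 k (by omega)]
    push_cast; ring

theorem IsInvFactorial.mul_eq (hf : IsInvFactorial f d) (i j : ℕ) (h : i + j ≤ d + 1) :
    f i * f j = ((i + j).choose i : R) * f (i + j) := by
  have hi := hf.factorial_mul i (by omega)
  have hj := hf.factorial_mul j (by omega)
  have hij := hf.factorial_mul (i + j) h
  have hc : (((i + j).choose i * i.factorial * j.factorial : ℕ) : R) = (i + j).factorial := by
    rw [Nat.choose_symm_add, Nat.add_choose_mul_factorial_mul_factorial]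
  push_cast at hc
  linear_combination (-(f i * f j)) * hij + f i * f j * f (i + j) * hc.symm +
    ((i + j).choose i : R) * f (i + j) * (j.factorial * f j) * hi +
    ((i + j).choose i : R) * f (i + j) * hj

-- The binomial theorem gives `e^{as} e^{bs} = e^{(a+b)s}` in every degree where the inverse
-- factorials exist.
open PowerSeries in
theorem IsInvFactorial.expTrunc_mul (hf : IsInvFactorial f d) (a b : R) :
    X ^ (d + 2) ∣ expTrunc f d a * expTrunc f d b - expTrunc f d (a + b) := by
  rw [X_pow_dvd_iff]
  intro n hn
  rw [map_sub, coeff_mul, sub_eq_zero]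
  simp only [expTrunc, coeff_mk]
  rw [if_pos (by omega), (Commute.all a b).add_pow', Finset.mul_sum]
  refine Finset.sum_congr rfl fun x hx => ?_
  have hx := Finset.HasAntidiagonal.mem_antidiagonal.1 hx
  rw [if_pos (by omega), if_pos (by omega), nsmul_eq_mul, ← hx]
  have := hf.mul_eq x.1 x.2 (by omega)
  linear_combination (a ^ x.1 * b ^ x.2) * this

open PowerSeries in
theorem IsInvFactorial.expTrunc_zero (hf : IsInvFactorial f d) : expTrunc f d 0 = 1 := by
  ext n
  cases n with
  | zero => simp [expTrunc, hf.1]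
  | succ n => simp [expTrunc, coeff_one]

open PowerSeries in
theorem IsInvFactorial.isUnit_expTrunc (hf : IsInvFactorial f d) (a : R) :
    IsUnit (expTrunc f d a) :=
  isUnit_of_constantCoeff (by
    simp [expTrunc, ← coeff_zero_eq_constantCoeff_apply, hf.1])

open PowerSeries in
/-- The integer powers of the truncated exponential. -/
theorem IsInvFactorial.zpow_expTrunc (hf : IsInvFactorial f d) {w : (PowerSeries R)ˣ}
    (hw : (w : PowerSeries R) = expTrunc f d 1) (n : ℤ) :
    X ^ (d + 2) ∣ ((w ^ n : (PowerSeries R)ˣ) : PowerSeries R) - expTrunc f d (n : R) := by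
  induction n using Int.induction_on with
  | zero => simp [hf.expTrunc_zero]
  | succ n ih =>
    have h := hf.expTrunc_mul (n : R) 1
    rw [zpow_add_one, Units.val_mul, hw]
    have := dvd_add (ih.mul_right (expTrunc f d 1)) h
    convert this using 1
    push_cast; ring
  | pred n ih =>
    have h := hf.expTrunc_mul ((-n - 1 : ℤ) : R) 1
    have hu := hf.isUnit_expTrunc 1
    -- To descend from `-n` to `-n - 1`, multiply by the unit `w` and use the addition law
    -- backwards.
    rw [← hu.dvd_mul_right]
    have e : ((w ^ (-(n : ℤ) - 1) : (PowerSeries R)ˣ) : PowerSeries R) * expTrunc f d 1 =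
        ((w ^ (-(n : ℤ)) : (PowerSeries R)ˣ) : PowerSeries R) := by
      rw [← hw, ← Units.val_mul, ← zpow_add_one, sub_add_cancel]
    have := dvd_sub ih h
    rw [sub_mul, e]
    convert this using 1
    push_cast
    rw [sub_add_cancel]
    ring

open PowerSeries in
theorem IsInvFactorial.expTrunc_eq (hf : IsInvFactorial f d) (a : R) :
    expTrunc f d a = 1 + X * (C a * rescale a (expQuot f d)) := by
  ext n
  cases n with
  | zero => simp [expTrunc, hf.1]
  | succ n =>
    rw [map_add, coeff_succ_X_mul, coeff_C_mul, coeff_rescale]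
    simp only [expTrunc, expQuot, coeff_mk, coeff_one]
    by_cases h : n ≤ d
    · rw [if_pos (by omega), if_pos h]; simp; ring
    · rw [if_neg (by omega), if_neg h]; simp

open PowerSeries in
/-- `1 - w^n` is `-n X` times a power series with constant coefficient one. -/
theorem IsInvFactorial.one_sub_zpow (hf : IsInvFactorial f d) {w : (PowerSeries R)ˣ}
    (hw : (w : PowerSeries R) = expTrunc f d 1) (n : ℤ) :
    ∃ V : PowerSeries R, 1 - ((w ^ n : (PowerSeries R)ˣ) : PowerSeries R) = X * V ∧
      X ^ (d + 1) ∣ V - C (-(n : R)) * rescale (n : R) (expQuot f d) := by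
  obtain ⟨Q, hQ⟩ := hf.zpow_expTrunc hw n
  refine ⟨-(X ^ (d + 1) * Q) + C (-(n : R)) * rescale (n : R) (expQuot f d), ?_, ⟨-Q, by ring⟩⟩
  rw [sub_eq_iff_eq_add] at hQ
  rw [hQ, hf.expTrunc_eq, map_neg]
  ring

open PowerSeries in
/-- The number of lattice points from the Laurent expansions of the cones. -/
theorem ShortSum.Represents.natCast_ncard {N : ℕ} {S : ShortSum (N + 1) d} {P : Set (Fin d → ℝ)}
    (hS : S.Represents P) (hP : (latticePoints P).Finite) (hf : IsInvFactorial f d)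
    (γ : Fin d → ℤ) (G : Fin (N + 1) → PowerSeries R) (c : Fin (N + 1) → R)
    (hG : ∀ i, G i * ∏ j, rescale ((∑ k, γ k * S.v i j k : ℤ) : R) (expQuot f d) =
      expTrunc f d ((∑ k, γ k * S.u i k : ℤ) : R))
    (hc : ∀ i, c i * ∏ j, (-((∑ k, γ k * S.v i j k : ℤ) : R)) = 1) :
    ((latticePoints P).ncard : R) =
      ∑ i, (((S.sign i : ℤˣ) : ℤ) : R) * (c i * coeff d (G i)) := by
  obtain ⟨w, hw⟩ := hf.isUnit_expTrunc 1
  have h := hS.map hP w γ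
  have hV := fun i j => hf.one_sub_zpow hw (∑ k, γ k * S.v i j k)
  choose V hV hV' using hV
  simp only [hV, Finset.prod_mul_distrib, Finset.prod_const, Finset.card_univ, Fintype.card_fin,
    Finset.card_erase_of_mem (Finset.mem_univ _), Nat.add_sub_cancel] at h
  set F := ∑ α ∈ hP.toFinset, ((w ^ (∑ k, γ k * α k) : (PowerSeries R)ˣ) : PowerSeries R) with hF
  -- The left side carries `X ^ (d(N + 1))` and each summand on the right `X ^ (dN)`; the surplus `X
  -- ^ d` is why the count appears in degree `d`.
  have h' : F * X ^ d * ∏ i, ∏ j, V i j = ∑ i, (((S.sign i : ℤˣ) : ℤ) : PowerSeries R) *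
      (((w ^ (∑ k, γ k * S.u i k) : (PowerSeries R)ˣ) : PowerSeries R) *
        ∏ i' ∈ Finset.univ.erase i, ∏ j, V i' j) := by
    refine X_pow_mul_cancel (k := d * N) ?_
    rw [Finset.mul_sum]
    refine Eq.trans ?_ (h.trans (Finset.sum_congr rfl fun i _ => ?_))
    · rw [← pow_mul]; ring
    · rw [← pow_mul]; ring
  let q := Ideal.Quotient.mk (Ideal.span {(X : PowerSeries R) ^ (d + 1)})
  have hq : ∀ x y, q x = q y ↔ X ^ (d + 1) ∣ x - y := fun x y => by
    rw [Ideal.Quotient.eq, Ideal.mem_span_singleton]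
  have hqV : ∀ i, q (∏ j, V i j) * q (C (c i) * G i) =
      q (((w ^ (∑ k, γ k * S.u i k) : (PowerSeries R)ˣ) : PowerSeries R)) := by
    intro i
    have e1 : q (∏ j, V i j) = q (∏ j, (C (-((∑ k, γ k * S.v i j k : ℤ) : R)) *
        rescale ((∑ k, γ k * S.v i j k : ℤ) : R) (expQuot f d))) := by
      rw [map_prod, map_prod]
      exact Finset.prod_congr rfl fun j _ => (hq _ _).mpr (hV' i j)
    have e2 : q (((w ^ (∑ k, γ k * S.u i k) : (PowerSeries R)ˣ) : PowerSeries R)) =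
        q (expTrunc f d ((∑ k, γ k * S.u i k : ℤ) : R)) :=
      (hq _ _).mpr ((pow_dvd_pow X (by omega)).trans (hf.zpow_expTrunc hw _))
    rw [e1, e2, ← map_mul, ← hG i, Finset.prod_mul_distrib, ← map_prod]
    congr 1
    have := congrArg C (hc i)
    rw [map_mul, map_one] at this
    linear_combination (G i * ∏ j, rescale ((∑ k, γ k * S.v i j k : ℤ) : R) (expQuot f d)) * this
  -- The constant coefficient of `V i j` is `-⟨γ, v_ij⟩`, a unit because `c i` inverts the product
  -- of these.
  have hunit : IsUnit (q (∏ i, ∏ j, V i j)) := by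
    refine IsUnit.map q ?_
    rw [IsUnit.prod_univ_iff]
    intro i
    rw [IsUnit.prod_univ_iff]
    intro j
    refine isUnit_of_constantCoeff ?_
    have h1 := (X_pow_dvd_iff.mp (hV' i j)) 0 (by omega)
    rw [map_sub, sub_eq_zero, coeff_C_mul, coeff_rescale, pow_zero, one_mul,
      coeff_zero_eq_constantCoeff_apply, coeff_zero_eq_constantCoeff_apply,
      hf.constantCoeff_expQuot, mul_one] at h1
    rw [h1]
    have := IsUnit.of_mul_eq_one_right _ (hc i)
    rw [IsUnit.prod_univ_iff] at this
    exact this j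
  have hmod : q (F * X ^ d) =
      q (∑ i, (((S.sign i : ℤˣ) : ℤ) : PowerSeries R) * (C (c i) * G i)) := by
    refine hunit.mul_left_cancel ?_
    rw [mul_comm, ← map_mul, h', map_sum, map_sum, Finset.mul_sum]
    refine Finset.sum_congr rfl fun i _ => ?_
    rw [map_mul, map_mul, ← hqV i, map_mul,
      ← Finset.mul_prod_erase Finset.univ (fun i => ∏ j, V i j) (Finset.mem_univ i)]
    simp only [map_mul]
    ring
  have hcoeff := X_pow_dvd_iff.mp ((hq _ _).mp hmod) d (by omega)
  rw [map_sub, sub_eq_zero, map_sum] at hcoeff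
  have hFd : coeff d (F * X ^ d) = ((latticePoints P).ncard : R) := by
    have := coeff_mul_X_pow F d 0
    rw [zero_add] at this
    rw [this, hF, map_sum, Set.ncard_eq_toFinset_card _ hP]
    rw [Finset.sum_congr rfl (g := fun _ => (1 : R))]
    · simp
    · intro α _
      -- Each power of `w` has constant coefficient one, so each lattice point counts once.
      have h1 := (X_pow_dvd_iff.mp (hf.zpow_expTrunc hw (∑ k, γ k * α k))) 0 (by omega)
      rw [map_sub, sub_eq_zero] at h1
      rw [h1]
      simp [expTrunc, hf.1]
  rw [← hFd, hcoeff]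
  refine Finset.sum_congr rfl fun i _ => ?_
  rw [← map_intCast (C (R := R)), coeff_C_mul, coeff_C_mul]

end Formula

/-- In `(ω ^ 2 ^ j + 1)(ω ^ 2 ^ j - 1) = 0` the second factor is not a zero divisor. -/
theorem IsPrimRoot.pow_half {R : Type*} [CommRing R] {ω : R} {j : ℕ}
    (h : IsPrimRoot ω (2 ^ (j + 1))) : ω ^ 2 ^ j = -1 := by
  have h1 := h.2.2 2 Nat.prime_two (dvd_pow_self 2 (by omega))
  rw [pow_succ, Nat.mul_div_cancel _ (by norm_num)] at h1
  have h2 : (ω ^ 2 ^ j + 1) * (ω ^ 2 ^ j - 1) = 0 := by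
    have := h.1
    rw [pow_succ, pow_mul] at this
    linear_combination this
  exact eq_neg_of_add_eq_zero_left ((mul_right_mem_nonZeroDivisors_eq_zero_iff h1).mp h2)

/-! ### Counting bad directions -/

section Count

/-- On the hyperplane a coordinate `k` with `v k ≠ 0` is determined by the others, so overwriting it
by an arbitrary element of `S` is injective. -/
theorem card_filter_linear_mul_le {K : Type*} [Field K] [DecidableEq K] {d : ℕ} (S : Finset K)
    (v : Fin d → K) (hv : ∃ k, v k ≠ 0) :
    ((Fintype.piFinset fun _ : Fin d => S).filter (fun z => ∑ k, z k * v k = 0)).card * S.card ≤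
      S.card ^ d := by
  obtain ⟨k, hk⟩ := hv
  rw [← Finset.card_product]
  have hcard : S.card ^ d = (Fintype.piFinset fun _ : Fin d => S).card := by simp
  rw [hcard]
  refine Finset.card_le_card_of_injOn (fun x => Function.update x.1 k x.2) ?_ ?_
  · rintro ⟨z, t⟩ h
    simp only [Finset.coe_product, Set.mem_prod, Finset.mem_coe, Finset.mem_filter,
      Fintype.mem_piFinset] at h ⊢
    intro i
    by_cases hi : i = k
    · subst hi; simpa using h.2
    · simpa [hi] using h.1.1 i
  · rintro ⟨z, t⟩ h ⟨z', t'⟩ h' heq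
    simp only [Finset.coe_product, Set.mem_prod, Finset.mem_coe, Finset.mem_filter] at h h' heq
    have ht : t = t' := by simpa using congrFun heq k
    have hz : ∀ i, i ≠ k → z i = z' i := fun i hi => by simpa [hi] using congrFun heq i
    have hzk : z k = z' k := by
      have h1 := h.1.2
      rw [← h'.1.2, ← Finset.add_sum_erase _ _ (Finset.mem_univ k),
        ← Finset.add_sum_erase _ (fun i => z' i * v i) (Finset.mem_univ k),
        Finset.sum_congr rfl (fun i hi => by rw [hz i (Finset.ne_of_mem_erase hi)])] at h1
      exact mul_right_cancel₀ hk (add_right_cancel h1)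
    refine Prod.ext (funext fun i => ?_) ht
    by_cases hi : i = k
    · subst hi; exact hzk
    · exact hz i hi

theorem card_filter_exists_linear_mul_le {K : Type*} [Field K] [DecidableEq K] {N d : ℕ}
    (S : Finset K) (v : Fin N → Fin d → Fin d → K) (hv : ∀ i j, ∃ k, v i j k ≠ 0) :
    ((Fintype.piFinset fun _ : Fin d => S).filter
      (fun z => ∃ i j, ∑ k, z k * v i j k = 0)).card * S.card ≤ N * d * S.card ^ d := by
  have hsub : (Fintype.piFinset fun _ : Fin d => S).filter
      (fun z => ∃ i j, ∑ k, z k * v i j k = 0) ⊆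
      (Finset.univ : Finset (Fin N × Fin d)).biUnion fun x =>
        (Fintype.piFinset fun _ : Fin d => S).filter (fun z => ∑ k, z k * v x.1 x.2 k = 0) := by
    intro z hz
    simp only [Finset.mem_filter, Finset.mem_biUnion, Finset.mem_univ, true_and] at hz ⊢
    obtain ⟨hz, i, j, h⟩ := hz
    exact ⟨(i, j), hz, h⟩
  calc _ ≤ (∑ x : Fin N × Fin d, ((Fintype.piFinset fun _ : Fin d => S).filter
        (fun z => ∑ k, z k * v x.1 x.2 k = 0)).card) * S.card :=
        Nat.mul_le_mul_right _ ((Finset.card_le_card hsub).trans Finset.card_biUnion_le)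
    _ = ∑ x : Fin N × Fin d, ((Fintype.piFinset fun _ : Fin d => S).filter
        (fun z => ∑ k, z k * v x.1 x.2 k = 0)).card * S.card := Finset.sum_mul _ _ _
    _ ≤ ∑ _x : Fin N × Fin d, S.card ^ d :=
        Finset.sum_le_sum fun x _ => card_filter_linear_mul_le S _ (hv x.1 x.2)
    _ = N * d * S.card ^ d := by simp

end Count

/-! ### Running straight-line code -/

section Run

variable {N d : ℕ} {R : Type*} [CommRing R]

/-- The memory after a list of computation steps. -/
noncomputable def runOps (ω : ℕ → R) (S : ShortSum N d) : List (Op N d) → List R → List R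
  | [], m => m
  | o :: os, m => runOps ω S os (m ++ [o.eval ω S m])

/-- Perform the steps `os` and continue with `T`. -/
def seqOps (os : List (Op N d)) (T : Prog N d) : Prog N d := os.foldr .compute T

theorem runOps_append (ω : ℕ → R) (S : ShortSum N d) (os os' : List (Op N d)) (m : List R) :
    runOps ω S (os ++ os') m = runOps ω S os' (runOps ω S os m) := by
  induction os generalizing m with
  | nil => rfl
  | cons o os ih => exact ih _

theorem length_runOps (ω : ℕ → R) (S : ShortSum N d) (os : List (Op N d)) (m : List R) :
    (runOps ω S os m).length = m.length + os.length := by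
  induction os generalizing m with
  | nil => rfl
  | cons o os ih =>
    rw [runOps, ih]
    simp only [List.length_append, List.length_cons, List.length_nil]
    omega

/-- For batches of steps that read only the initial memory: the results appear at predictable
positions. -/
theorem runOps_eq_of_stable (ω : ℕ → R) (S : ShortSum N d) (os : List (Op N d)) (m : List R)
    (h : ∀ o ∈ os, ∀ l, o.eval ω S (m ++ l) = o.eval ω S m) (l : List R) :
    runOps ω S os (m ++ l) = m ++ l ++ os.map (Op.eval ω S m) := by
  induction os generalizing l with
  | nil => simp [runOps]
  | cons o os ih =>
    rw [runOps, h o (by simp), List.append_assoc, ih fun o ho => h o (by simp [ho])]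
    simp

theorem outputs_seqOps (p : ℕ) [Algebra (ZMod p) R] (ω : ℕ → R) (S : ShortSum N d) (x : R)
    (os : List (Op N d)) (T : Prog N d) (m : List R) :
    (seqOps os T).Outputs p ω S x m ↔ T.Outputs p ω S x (runOps ω S os m) := by
  induction os generalizing m with
  | nil => rfl
  | cons o os ih => exact ih _

theorem expCost_seqOps (p : ℕ) [NeZero p] [Algebra (ZMod p) R] (a b : ℝ) (ω : ℕ → R)
    (S : ShortSum N d) (os : List (Op N d)) (T : Prog N d) (m : List R) :
    (seqOps os T).expCost p a b ω S m =
      (os.map (Op.cost a b)).sum + T.expCost p a b ω S (runOps ω S os m) := by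
  induction os generalizing m with
  | nil => simp [seqOps, runOps]
  | cons o os ih =>
    have := ih (m ++ [o.eval ω S m])
    simp only [seqOps, List.foldr_cons, Prog.expCost, runOps, List.map_cons, List.sum_cons] at this ⊢
    rw [this]; ring

theorem getD_of_getElem? {m : List R} {q : ℕ} {x : R} (h : m[q]? = some x) (l : List R) :
    (m ++ l).getD q 0 = x := by
  rw [List.getD_eq_getElem?_getD, List.getElem?_append_left (List.getElem?_eq_some_iff.mp h).1, h]
  rfl

omit [CommRing R] in
theorem getElem?_append_of_eq_some {m : List R} {q : ℕ} {x : R} (h : m[q]? = some x) (l : List R) :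
    (m ++ l)[q]? = some x := by
  rw [List.getElem?_append_left (List.getElem?_eq_some_iff.mp h).1, h]

end Run

/-- A straight-line computation over a product of rings is realized by one list of steps, which
works for all factors simultaneously. -/
theorem Comp.realize {N d : ℕ} {ι : Type*} {R : ι → Type*} [∀ e, CommRing (R e)]
    (ω : ∀ e, ℕ → R e) (S : ι → ShortSum N d) {t : ℕ} {X Y : Set (∀ e, R e)}
    (h : Comp (fun k e => ω e k) t X Y) (ℓ : ℕ) (mem : ∀ e, List (R e))
    (hlen : ∀ e, (mem e).length = ℓ) (hX : ∀ x ∈ X, ∃ q : ℕ, ∀ e, (mem e)[q]? = some (x e)) :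
    ∃ os : List (Op N d), os.length ≤ t ∧ (∀ a b, (os.map (Op.cost a b)).sum = os.length * a) ∧
      ∀ y ∈ Y, ∃ q : ℕ, ∀ e, (runOps (ω e) (S e) os (mem e))[q]? = some (y e) := by
  induction h generalizing ℓ mem with
  | done h => exact ⟨[], by simp, by simp, fun y hy => hX y (h hy)⟩
  | @step t X Y a h _ ih =>
    obtain ⟨o, hcost, ho⟩ : ∃ o : Op N d, (∀ a b, o.cost a b = a) ∧
        ∀ e, o.eval (ω e) (S e) (mem e) = a e := by
      have get : ∀ {x}, x ∈ X → ∃ q, ∀ e, (mem e).getD q 0 = x e := fun hx => by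
        obtain ⟨q, hq⟩ := hX _ hx
        exact ⟨q, fun e => by simpa using getD_of_getElem? (hq e) []⟩
      cases h with
      | zero => exact ⟨.zero, fun _ _ => rfl, fun e => rfl⟩
      | one => exact ⟨.one, fun _ _ => rfl, fun e => rfl⟩
      | root k => exact ⟨.root k, fun _ _ => rfl, fun e => rfl⟩
      | add hx hy =>
        obtain ⟨q, hq⟩ := get hx
        obtain ⟨q', hq'⟩ := get hy
        exact ⟨.add q q', fun _ _ => rfl, fun e => by simp only [Op.eval, hq, hq']; rfl⟩
      | sub hx hy =>
        obtain ⟨q, hq⟩ := get hx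
        obtain ⟨q', hq'⟩ := get hy
        exact ⟨.sub q q', fun _ _ => rfl, fun e => by simp only [Op.eval, hq, hq']; rfl⟩
      | mul hx hy =>
        obtain ⟨q, hq⟩ := get hx
        obtain ⟨q', hq'⟩ := get hy
        exact ⟨.mul q q', fun _ _ => rfl, fun e => by simp only [Op.eval, hq, hq']; rfl⟩
      | @inv x _ hx hxy =>
        obtain ⟨q, hq⟩ := get hx
        refine ⟨.inv q, fun _ _ => rfl, fun e => ?_⟩
        have he : x e * a e = 1 := congrFun hxy e
        simp only [Op.eval, hq]
        exact Ring.inverse_unit (Units.mkOfMulEqOne _ _ he)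
    -- All memories have the same length `ℓ`, so the new entry has the same address in every factor.
    obtain ⟨os, hos, hc, hY⟩ := ih (ℓ + 1) (fun e => mem e ++ [a e]) (by simp [hlen]) (by
      intro x hx
      rcases hx with rfl | hx
      · exact ⟨ℓ, fun e => by simp [← hlen e]⟩
      · obtain ⟨q, hq⟩ := hX x hx
        exact ⟨q, fun e => getElem?_append_of_eq_some (hq e) _⟩)
    refine ⟨o :: os, by simpa using hos, fun a b => ?_, fun y hy => ?_⟩
    · simp only [List.map_cons, List.sum_cons, hcost, hc, List.length_cons]
      push_cast; ring
    · obtain ⟨q, hq⟩ := hY y hy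
      exact ⟨q, fun e => by rw [runOps, ho]; exact hq e⟩

/-! ### Zero tests and random samples -/

section Control

variable {N d p : ℕ} [NeZero p] {R : Type*} [CommRing R] [Algebra (ZMod p) R]

/-- Continue with `bad` as soon as one of the entries at the positions `qs` vanishes, and with
`good` otherwise. -/
def testAll (qs : List ℕ) (good bad : Prog N d) : Prog N d :=
  qs.foldr (fun q T => .ifZero q bad T) good

omit [NeZero p] in
theorem outputs_testAll (ω : ℕ → R) (S : ShortSum N d) (x : R) (qs : List ℕ) (good bad : Prog N d)
    (m : List R) (hgood : (∀ q ∈ qs, m.getD q 0 ≠ 0) → good.Outputs p ω S x m)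
    (hbad : (∃ q ∈ qs, m.getD q 0 = 0) → bad.Outputs p ω S x m) :
    (testAll qs good bad).Outputs p ω S x m := by
  induction qs with
  | nil => exact hgood (by simp)
  | cons q qs ih =>
    refine ⟨fun h => hbad ⟨q, by simp, h⟩, fun h => ih (fun h' => hgood ?_) fun ⟨q', h1, h2⟩ =>
      hbad ⟨q', by simp [h1], h2⟩⟩
    exact List.forall_mem_cons.mpr ⟨h, h'⟩

theorem expCost_testAll_le {a : ℝ} (ha : 0 ≤ a) (b : ℝ) (ω : ℕ → R) (S : ShortSum N d)
    (qs : List ℕ) (good bad : Prog N d) (m : List R) (C : ℝ)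
    (hgood : (∀ q ∈ qs, m.getD q 0 ≠ 0) → good.expCost p a b ω S m ≤ C)
    (hbad : (∃ q ∈ qs, m.getD q 0 = 0) → bad.expCost p a b ω S m ≤ C) :
    (testAll qs good bad).expCost p a b ω S m ≤ qs.length * a + C := by
  induction qs with
  | nil => simpa [testAll] using hgood (by simp)
  | cons q qs ih =>
    simp only [testAll, List.foldr_cons, Prog.expCost, List.length_cons]
    have hnn : 0 ≤ (qs.length : ℝ) * a := by positivity
    push_cast
    split_ifs with h
    · have := hbad ⟨q, by simp, h⟩
      linarith
    · have := ih (fun h' => hgood (List.forall_mem_cons.mpr ⟨h, h'⟩)) fun ⟨q', h1, h2⟩ =>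
        hbad ⟨q', by simp [h1], h2⟩
      simp only [testAll] at this
      linarith

omit [NeZero p] in
theorem outputs_sample_iterate (ω : ℕ → R) (S : ShortSum N d) (x : R) (n : ℕ) (T : Prog N d)
    (m : List R)
    (h : ∀ z : Fin n → ZMod p, T.Outputs p ω S x
      (m ++ List.ofFn fun k => algebraMap (ZMod p) R (z k))) :
    (Prog.sample^[n] T).Outputs p ω S x m := by
  induction n generalizing m with
  | zero => simpa using h 0
  | succ n ih =>
    rw [Function.iterate_succ_apply']
    intro z₀
    refine ih _ fun z => ?_
    have := h (Fin.cons z₀ z)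
    simpa [List.ofFn_succ] using this

theorem expCost_sample_iterate (a b : ℝ) (ω : ℕ → R) (S : ShortSum N d) (n : ℕ) (T : Prog N d)
    (m : List R) : (Prog.sample^[n] T).expCost p a b ω S m = n * a +
      (∑ z : Fin n → ZMod p, T.expCost p a b ω S
        (m ++ List.ofFn fun k => algebraMap (ZMod p) R (z k))) / (p : ℝ) ^ n := by
  have hp : (p : ℝ) ≠ 0 := by exact_mod_cast NeZero.ne p
  induction n generalizing m with
  | zero => simp
  | succ n ih =>
    rw [Function.iterate_succ_apply', Prog.expCost]
    simp only [ih, Finset.sum_add_distrib, ← Finset.sum_div]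
    rw [← (Fin.consEquiv fun _ : Fin (n + 1) => ZMod p).sum_comp, Fintype.sum_prod_type]
    simp only [Fin.consEquiv_apply, List.ofFn_succ, Fin.cons_zero, Fin.cons_succ,
      Finset.sum_const, Finset.card_univ, ZMod.card, nsmul_eq_mul, List.append_assoc,
      List.singleton_append, Nat.cast_succ]
    field_simp
    ring

end Control
universe u

/-! ### The randomized algorithm -/

/-- The inputs for which a program in `Prog N d` has to work. -/
structure Input (N d L : ℕ) (c : ℝ) : Type (u + 1) where
  p : ℕ
  prime : Fact p.Prime
  R : Type u
  ring : CommRing R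
  nontriv : Nontrivial R
  alg : Algebra (ZMod p) R
  ω : ℕ → R
  P : Set (Fin d → ℝ)
  S : ShortSum N d
  le_p : c * ((N : ℝ) * (d : ℝ)) ≤ (p : ℝ)
  primRoot : ∀ k : ℕ, 2 ^ k ≤ L * d → IsPrimRoot (ω k) (2 ^ k)
  polytope : IsRationalPolytope P
  represents : S.Represents P
  not_dvd : ∀ i j, ∃ k, ¬ (p : ℤ) ∣ S.v i j k

attribute [instance] Input.prime Input.ring Input.nontriv Input.alg

namespace Input

variable {N d L : ℕ} {c : ℝ}

/-- The exponent `⟨γ, v_ij⟩` modulo `p`. -/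
def exponent (I : Input.{u} N d L c) (z : Fin d → ZMod I.p) (i : Fin N) (j : Fin d) : ZMod I.p :=
  ∑ k, z k * (I.S.v i j k : ZMod I.p)

/-- No denominator vanishes in the direction `z`. -/
def Good (I : Input.{u} N d L c) (z : Fin d → ZMod I.p) : Prop := ∀ i j, I.exponent z i j ≠ 0

/-- The program computes the number of lattice points. -/
def Correct (I : Input.{u} N d L c) (T : Prog N d) (m : List I.R) : Prop :=
  T.Outputs I.p I.ω I.S (((latticePoints I.P).ncard : ℕ) : I.R) m

/-- At most `y` expected substitutions and `x` other expected steps. -/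
def CostLE (I : Input.{u} N d L c) (T : Prog N d) (m : List I.R) (x y : ℝ) : Prop :=
  ∀ a b : ℝ, 0 ≤ a → 0 ≤ b → T.expCost I.p a b I.ω I.S m ≤ a * x + b * y

theorem mul_lt_p (I : Input.{u} N d L c) (hc : 1 < c) (hN : 0 < N) (hd : 0 < d) :
    N * d < I.p := by
  have h := I.le_p
  have hpos : (0 : ℝ) < (N : ℝ) * d := by positivity
  have : ((N * d : ℕ) : ℝ) < (I.p : ℝ) := by
    push_cast
    nlinarith
  exact_mod_cast this

theorem isUnit_natCast (I : Input.{u} N d L c) {n : ℕ} (h0 : 0 < n) (hn : n < I.p) :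
    IsUnit ((n : ℕ) : I.R) := by
  have : (n : ZMod I.p) ≠ 0 := by
    rw [Ne, ZMod.natCast_eq_zero_iff]
    exact Nat.not_dvd_of_pos_of_lt h0 hn
  simpa using (IsUnit.mk0 _ this).map (algebraMap (ZMod I.p) I.R)

theorem exists_ne_zero (I : Input.{u} N d L c) (i : Fin N) (j : Fin d) :
    ∃ k, (I.S.v i j k : ZMod I.p) ≠ 0 := by
  obtain ⟨k, hk⟩ := I.not_dvd i j
  exact ⟨k, by rwa [Ne, ZMod.intCast_zmod_eq_zero_iff_dvd]⟩

/-- Powers of `w` need integer exponents, so the direction is lifted from `ZMod p` to `ℤ` by `val`.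
-/
theorem exponent_eq_intCast (I : Input.{u} N d L c) (z : Fin d → ZMod I.p) (v : Fin d → ℤ) :
    algebraMap (ZMod I.p) I.R (∑ k, z k * (v k : ZMod I.p)) =
      ((∑ k, ((z k).val : ℤ) * v k : ℤ) : I.R) := by
  rw [← map_intCast (algebraMap (ZMod I.p) I.R)]
  congr 1
  push_cast
  simp

/-- A good direction can be found in the grid `{0, …, Nd}^d`. -/
theorem exists_good_grid (I : Input.{u} N d L c) (hc : 1 < c) (hN : 0 < N) (hd : 0 < d) :
    ∃ w : Fin d → Fin (N * d + 1), I.Good fun k => ((w k : ℕ) : ZMod I.p) := by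
  have hp := I.mul_lt_p hc hN hd
  -- Because `N * d < p`, the `N * d + 1` values remain distinct modulo `p`; one value more than
  -- there are linear forms defeats the union bound.
  let S : Finset (ZMod I.p) := (Finset.univ : Finset (Fin (N * d + 1))).image
    fun n : Fin (N * d + 1) => ((n : ℕ) : ZMod I.p)
  have hS : S.card = N * d + 1 := by
    rw [Finset.card_image_of_injective, Finset.card_univ, Fintype.card_fin]
    intro n n' h
    have hn := n.2
    have hn' := n'.2
    simp only [ZMod.natCast_eq_natCast_iff'] at h
    rw [Nat.mod_eq_of_lt (by omega), Nat.mod_eq_of_lt (by omega)] at h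
    exact Fin.ext h
  have hcard := card_filter_exists_linear_mul_le S
    (fun i j k => (I.S.v i j k : ZMod I.p)) I.exists_ne_zero
  by_contra! hno
  have hall : (Fintype.piFinset fun _ : Fin d => S).filter
      (fun z => ∃ i j, ∑ k, z k * (I.S.v i j k : ZMod I.p) = 0) =
        Fintype.piFinset fun _ : Fin d => S := by
    refine Finset.filter_true_of_mem fun z hz => ?_
    rw [Fintype.mem_piFinset] at hz
    have : ∀ k, ∃ n : Fin (N * d + 1), ((n : ℕ) : ZMod I.p) = z k := fun k => by
      simpa [S] using hz k
    choose w hw using this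
    have hb := hno w
    simp only [Good, not_forall, not_not, hw] at hb
    exact hb
  rw [hall, Fintype.card_piFinset_const, hS, mul_comm] at hcard
  have hpos : 0 < (N * d + 1) ^ d := by positivity
  have := Nat.le_of_mul_le_mul_right hcard hpos
  omega

open Classical in
/-- A random direction is bad with probability at most `1 / c`. -/
theorem card_bad_le (I : Input.{u} N d L c) (hc : 1 < c) :
    c * ((Finset.univ.filter fun z : Fin d → ZMod I.p => ¬ I.Good z).card : ℝ) ≤
      (I.p : ℝ) ^ d := by
  have hcard := card_filter_exists_linear_mul_le (Finset.univ : Finset (ZMod I.p))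
    (fun i j k => (I.S.v i j k : ZMod I.p)) I.exists_ne_zero
  rw [Fintype.piFinset_univ, Finset.card_univ, ZMod.card] at hcard
  have heq : (Finset.univ.filter fun z : Fin d → ZMod I.p => ¬ I.Good z) =
      Finset.univ.filter fun z => ∃ i j, ∑ k, z k * (I.S.v i j k : ZMod I.p) = 0 := by
    ext z
    simp [Good, exponent]
  rw [heq]
  have hcard' : (((Finset.univ.filter fun z : Fin d → ZMod I.p =>
      ∃ i j, ∑ k, z k * (I.S.v i j k : ZMod I.p) = 0).card : ℕ) : ℝ) * I.p ≤
        N * d * (I.p : ℝ) ^ d := by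
    have := (Nat.cast_le (α := ℝ)).mpr hcard
    push_cast at this
    convert this using 1
  have hppos : (0 : ℝ) < I.p := by exact_mod_cast I.prime.out.pos
  have hle := I.le_p
  refine le_of_mul_le_mul_right ?_ hppos
  calc _ = c * (((Finset.univ.filter fun z : Fin d → ZMod I.p =>
      ∃ i j, ∑ k, z k * (I.S.v i j k : ZMod I.p) = 0).card : ℝ) * I.p) := by ring
    _ ≤ c * (N * d * (I.p : ℝ) ^ d) := mul_le_mul_of_nonneg_left hcard' (by linarith)
    _ = (c * (N * d)) * (I.p : ℝ) ^ d := by ring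
    _ ≤ I.p * (I.p : ℝ) ^ d := mul_le_mul_of_nonneg_right hle (by positivity)
    _ = _ := by ring

end Input

/-! ### Assembling the program and bounding its expected cost -/

variable {N d k : ℕ} {c : ℝ}

/-- The number of steps after a good direction has been found. -/
def finishCost (N k : ℕ) : ℝ := N + (230 * (N + 1) * (k + 1) ^ 2 * 2 ^ k : ℕ)

/-- With the exponents `⟨γ, v_ij⟩` at the positions `r i j`, the computation is completed by the
straight-line algorithm. -/
theorem exists_finish (hc : 1 < c) (hN : 2 ≤ N) (hd : 1 ≤ d) (hk : d < 2 ^ k)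
    (hk' : 2 ^ k ≤ 2 * d) (ℓ : ℕ) (g : Fin d → ℕ) (r : Fin N → Fin d → ℕ) :
    ∃ T : Prog N d, ∀ (I : Input.{u} N d 8 c) (m : List I.R) (z : Fin d → ZMod I.p),
      m.length = ℓ → (∀ k, m[g k]? = some (algebraMap _ _ (z k))) →
      (∀ i j, m[r i j]? = some (algebraMap _ _ (I.exponent z i j))) → I.Good z →
      I.Correct T m ∧ I.CostLE T m (finishCost N k) N := by
  obtain ⟨M, rfl⟩ : ∃ M, N = M + 1 := ⟨N - 1, by omega⟩
  -- All situations in which the program may be started. Computing in the product of their rings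
  -- yields steps that do not depend on the situation; the set `X` below consists of the families
  -- stored at a common position.
  let ι := {e : (I : Input.{u} (M + 1) d 8 c) × (List I.R × (Fin d → ZMod I.p)) //
    e.2.1.length = ℓ ∧ (∀ k, e.2.1[g k]? = some (algebraMap _ _ (e.2.2 k))) ∧
    (∀ i j, e.2.1[r i j]? = some (algebraMap _ _ (e.1.exponent e.2.2 i j))) ∧ e.1.Good e.2.2}
  let R : ι → Type u := fun e => e.1.1.R
  let ω : ∀ e : ι, ℕ → R e := fun e => e.1.1.ω
  let S : ι → ShortSum (M + 1) d := fun e => e.1.1.S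
  let ops : List (Op (M + 1) d) := List.ofFn (fun i => Op.substU i g) ++ List.ofFn Op.sign
  let mem : ∀ e : ι, List (R e) := fun e => e.1.2.1 ++ ops.map (Op.eval (ω e) (S e) e.1.2.1)
  let a : Fin (M + 1) → Fin d → ∀ e, R e := fun i j e => algebraMap _ _ (e.1.1.exponent e.1.2.2 i j)
  let b : Fin (M + 1) → ∀ e, R e := fun i e =>
    algebraMap (ZMod e.1.1.p) e.1.1.R (∑ k, e.1.2.2 k * (e.1.1.S.u i k : ZMod e.1.1.p))
  let s : Fin (M + 1) → ∀ e, R e := fun i e => (((e.1.1.S.sign i : ℤˣ) : ℤ) : e.1.1.R)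
  have hrun : ∀ e : ι, runOps (ω e) (S e) ops e.1.2.1 = mem e := by
    intro e
    have := runOps_eq_of_stable (ω e) (S e) ops e.1.2.1 (fun o ho l => ?_) []
    · simpa using this
    · simp only [ops, List.mem_append, List.mem_ofFn] at ho
      rcases ho with ⟨i, rfl⟩ | ⟨i, rfl⟩
      · refine Finset.sum_congr rfl fun k _ => ?_
        rw [getD_of_getElem? (e.2.2.1 k) l]
        have := getD_of_getElem? (e.2.2.1 k) []
        rw [List.append_nil] at this
        rw [this]
      · rfl
  let X : Set (∀ e, R e) := {x | ∃ q : ℕ, ∀ e, (mem e)[q]? = some (x e)}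
  have haX : ∀ i j, a i j ∈ X := fun i j =>
    ⟨r i j, fun e => getElem?_append_of_eq_some (e.2.2.2.1 i j) _⟩
  have hbX : ∀ i, b i ∈ X := fun i => by
    refine ⟨ℓ + i, fun e => ?_⟩
    have hl := e.2.1
    simp only [mem, ops, List.map_append, List.map_ofFn]
    rw [List.getElem?_append_right (by omega), List.getElem?_append_left (by simp; omega),
      List.getElem?_ofFn, dif_pos (by omega)]
    congr 1
    simp only [Function.comp, Op.eval, b, map_sum, map_mul, map_intCast, hl, Nat.add_sub_cancel_left]
    refine Finset.sum_congr rfl fun k _ => ?_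
    have := getD_of_getElem? (e.2.2.1 k) []
    rw [List.append_nil] at this
    rw [this]
  have hsX : ∀ i, s i ∈ X := fun i => by
    refine ⟨ℓ + (M + 1) + i, fun e => ?_⟩
    have hl := e.2.1
    simp only [mem, ops, List.map_append, List.map_ofFn]
    rw [List.getElem?_append_right (by omega), List.getElem?_append_right (by simp; omega),
      List.getElem?_ofFn, dif_pos (by simp; omega)]
    congr 1
    simp only [Function.comp, Op.eval, s, List.length_ofFn]
    congr!
    omega
  have hunits : ∀ i j, IsUnit (a i j) := fun i j => by
    rw [Pi.isUnit_iff]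
    exact fun e => (IsUnit.mk0 _ (e.2.2.2.2 i j)).map _
  have hnat : ∀ n : ℕ, 1 ≤ n → n ≤ d + 1 → IsUnit (n : ∀ e, R e) := fun n h1 h2 => by
    rw [Pi.isUnit_iff]
    intro e
    have := e.1.1.mul_lt_p hc (by omega) (by omega)
    -- Here `N ≥ 2` matters: `p > Nd ≥ 2d ≥ d + 1`.
    have h2d : 2 * d ≤ (M + 1) * d := Nat.mul_le_mul_right _ hN
    exact e.1.1.isUnit_natCast (by omega) (by omega)
  have hω : ∀ j ≤ k + 1, (fun e => ω e (j + 1)) ^ 2 ^ j = (-1 : ∀ e, R e) := fun j hj => by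
    funext e
    refine (e.1.1.primRoot (j + 1) ?_).pow_half
    -- The longest transform has length `2 ^ (k + 2) ≤ 8d`, whence `L = 8`.
    calc 2 ^ (j + 1) ≤ 2 ^ (k + 2) := Nat.pow_le_pow_right (by norm_num) (by omega)
      _ = 4 * 2 ^ k := by ring
      _ ≤ 8 * d := by omega
  obtain ⟨f, G, cf, hf, hG, hcf, hcomp⟩ := Comp.sum_cones (ω := fun k e => ω e k) k hd hk hω hnat
    a b s hunits X haX hbX hsX
  obtain ⟨os, hos, hcost, hY⟩ := hcomp.realize ω S (ℓ + (M + 1 + (M + 1))) mem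
    (fun e => by simp [mem, ops, e.2.1]; omega) (fun x hx => hx)
  obtain ⟨q, hq⟩ := hY _ rfl
  refine ⟨seqOps (ops ++ os) (.output q), fun I m z hm hg hr hz => ?_⟩
  let e : ι := ⟨⟨I, m, z⟩, hm, hg, hr, hz⟩
  have hfin : (runOps I.ω I.S (ops ++ os) m).getD q 0 =
      (∑ i, s i * (cf i * PowerSeries.coeff d (G i))) e := by
    rw [runOps_append]
    have h1 := hrun e
    have h2 := hq e
    rw [← h1] at h2
    rw [List.getD_eq_getElem?_getD]
    exact congrArg (fun o => Option.getD o 0) h2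
  constructor
  · rw [Input.Correct, outputs_seqOps]
    show (runOps I.ω I.S (ops ++ os) m).getD q 0 = _
    rw [hfin]
    let φ := Pi.evalRingHom R e
    have hfe : IsInvFactorial (fun n => f n e) d :=
      ⟨congrFun hf.1 e, fun n hn => congrFun (hf.2 n hn) e⟩
    have hquot : PowerSeries.map φ (expQuot f d) = expQuot (fun n => f n e) d := by
      ext n
      simp only [expQuot, PowerSeries.coeff_map, PowerSeries.coeff_mk]
      split_ifs
      · rfl
      · exact map_zero φ
    have htrunc : ∀ x : ∀ e, R e, PowerSeries.map φ (expTrunc f d x) =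
        expTrunc (fun n => f n e) d (x e) := fun x => by
      ext n
      simp only [expTrunc, PowerSeries.coeff_map, PowerSeries.coeff_mk]
      split_ifs
      · rfl
      · exact map_zero φ
    have hae : ∀ i j, a i j e = ((∑ k, ((z k).val : ℤ) * I.S.v i j k : ℤ) : I.R) :=
      fun i j => I.exponent_eq_intCast z _
    have key := I.represents.natCast_ncard (finite_latticePoints I.polytope) hfe
      (fun k => ((z k).val : ℤ)) (fun i => PowerSeries.map φ (G i)) (fun i => cf i e)
      (fun i => by
        have h := congrArg (PowerSeries.map φ) (hG i)
        rw [map_mul, map_prod, htrunc] at h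
        rw [← I.exponent_eq_intCast z (I.S.u i)]
        refine Eq.trans ?_ h
        congr 1
        refine Finset.prod_congr rfl fun j _ => ?_
        rw [← PowerSeries.rescale_map, hquot, ← hae]
        rfl)
      (fun i => by
        have h := congrFun (hcf i) e
        rw [Pi.mul_apply, Finset.prod_apply] at h
        refine Eq.trans ?_ h
        congr 1
        refine Finset.prod_congr rfl fun j _ => ?_
        rw [← hae]
        rfl)
    rw [key, Finset.sum_apply]
    rfl
  · intro α β hα hβ
    rw [expCost_seqOps, List.map_append, List.sum_append, hcost, Prog.expCost, add_zero]
    have h1 : (ops.map (Op.cost α β)).sum = (M + 1 : ℕ) * β + (M + 1 : ℕ) * α := by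
      simp [ops, List.map_ofFn, Function.comp_def, Op.cost]
      ring
    rw [h1, finishCost]
    have h2 : ((os.length : ℕ) : ℝ) ≤ ((230 * (M + 1 + 1) * (k + 1) ^ 2 * 2 ^ k : ℕ) : ℝ) := by
      exact_mod_cast hos
    have := mul_le_mul_of_nonneg_right h2 hα
    nlinarith

/-- Try the direction at the positions `g`: finish if it is good, and continue with `F` if it is
not. -/
theorem exists_attempt (hc : 1 < c) (hN : 2 ≤ N) (hd : 1 ≤ d) (hk : d < 2 ^ k)
    (hk' : 2 ^ k ≤ 2 * d) (ℓ : ℕ) (g : Fin d → ℕ) (F : Prog N d) :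
    ∃ T : Prog N d, ∀ (I : Input.{u} N d 8 c) (m : List I.R) (z : Fin d → ZMod I.p),
      m.length = ℓ → (∀ k, m[g k]? = some (algebraMap _ _ (z k))) →
      (I.Good z → I.Correct T m ∧ I.CostLE T m (N * d + finishCost N k) (N * d + N)) ∧
      (¬ I.Good z → ∃ l : List I.R, l.length = N * d ∧
        (I.Correct F (m ++ l) → I.Correct T m) ∧
        ∀ x y, I.CostLE F (m ++ l) x y → I.CostLE T m (N * d + x) (N * d + y)) := by
  let pos : Fin N → Fin d → ℕ := fun i j => ℓ + finProdFinEquiv (i, j)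
  obtain ⟨T₀, hT₀⟩ := exists_finish.{u} hc hN hd hk hk' (ℓ + N * d) g pos
  let ops : List (Op N d) := List.ofFn fun x : Fin (N * d) =>
    Op.substV (finProdFinEquiv.symm x).1 (finProdFinEquiv.symm x).2 g
  let qs : List ℕ := List.ofFn fun x : Fin (N * d) => ℓ + (x : ℕ)
  refine ⟨seqOps ops (testAll qs T₀ F), fun I m z hm hg => ?_⟩
  have hg' : ∀ k l, (m ++ l).getD (g k) 0 = algebraMap _ _ (z k) := fun k l =>
    getD_of_getElem? (hg k) l
  have hg'' : ∀ k, m.getD (g k) 0 = algebraMap _ _ (z k) := fun k => by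
    simpa only [List.append_nil] using hg' k []
  have hrun : runOps I.ω I.S ops m = m ++ ops.map (Op.eval I.ω I.S m) := by
    have := runOps_eq_of_stable I.ω I.S ops m (fun o ho l => ?_) []
    · simpa using this
    · simp only [ops, List.mem_ofFn] at ho
      obtain ⟨x, rfl⟩ := ho
      exact Finset.sum_congr rfl fun k _ => by rw [hg', hg'']
  set l := ops.map (Op.eval I.ω I.S m) with hl
  have hlen : l.length = N * d := by simp [hl, ops]
  have hget : ∀ x : Fin (N * d), (m ++ l)[ℓ + (x : ℕ)]? = some (algebraMap _ _
      (I.exponent z (finProdFinEquiv.symm x).1 (finProdFinEquiv.symm x).2)) := by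
    intro x
    rw [List.getElem?_append_right (by omega), hm, Nat.add_sub_cancel_left, hl]
    simp only [ops, List.map_ofFn]
    rw [List.getElem?_ofFn, dif_pos x.2]
    congr 1
    simp only [Function.comp, Op.eval, Input.exponent, map_sum, map_mul, map_intCast, hg'']
  have hpos : ∀ i j, (m ++ l)[pos i j]? = some (algebraMap _ _ (I.exponent z i j)) := by
    intro i j
    have := hget (finProdFinEquiv (i, j))
    rwa [Equiv.symm_apply_apply] at this
  have hgl : ∀ k, (m ++ l)[g k]? = some (algebraMap _ _ (z k)) := fun k =>
    getElem?_append_of_eq_some (hg k) l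
  have hzero : ∀ x : ZMod I.p, algebraMap (ZMod I.p) I.R x = 0 ↔ x = 0 := fun x =>
    map_eq_zero_iff _ (algebraMap (ZMod I.p) I.R).injective
  have hgetD : ∀ x : Fin (N * d), (m ++ l).getD (ℓ + (x : ℕ)) 0 = algebraMap _ _
      (I.exponent z (finProdFinEquiv.symm x).1 (finProdFinEquiv.symm x).2) := fun x => by
    rw [List.getD_eq_getElem?_getD, hget x]; rfl
  have htest : (∀ q ∈ qs, (m ++ l).getD q 0 ≠ 0) ↔ I.Good z := by
    simp only [qs, List.mem_ofFn, forall_exists_index, forall_apply_eq_imp_iff, hgetD, Ne, hzero]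
    constructor
    · intro h i j
      simpa using h (finProdFinEquiv (i, j))
    · intro h x
      exact h _ _
  have htest' : (∃ q ∈ qs, (m ++ l).getD q 0 = 0) ↔ ¬ I.Good z := by
    rw [← htest]; push Not; rfl
  have hops : ∀ α β : ℝ, (ops.map (Op.cost α β)).sum = (N * d : ℝ) * β := fun α β => by
    simp [ops, List.map_ofFn, Function.comp_def, Op.cost]
  have hqs : (qs.length : ℝ) = N * d := by simp [qs]
  have hcost : ∀ α β C : ℝ, 0 ≤ α →
      (I.Good z → T₀.expCost I.p α β I.ω I.S (m ++ l) ≤ C) →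
      (¬ I.Good z → F.expCost I.p α β I.ω I.S (m ++ l) ≤ C) →
      (seqOps ops (testAll qs T₀ F)).expCost I.p α β I.ω I.S m ≤
        (N * d : ℝ) * β + ((N * d : ℝ) * α + C) := by
    intro α β C hα h1 h2
    rw [expCost_seqOps, hrun, hops, ← hqs]
    exact add_le_add_right (expCost_testAll_le hα β I.ω I.S qs T₀ F _ C
      (fun h => h1 (htest.mp h)) (fun h => h2 (htest'.mp h))) _
  constructor
  · intro hz
    obtain ⟨h1, h2⟩ := hT₀ I (m ++ l) z (by simp [hm, hlen]) hgl hpos hz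
    constructor
    · rw [Input.Correct, outputs_seqOps, hrun]
      exact outputs_testAll _ _ _ _ _ _ _ (fun _ => h1) fun h => absurd hz (htest'.mp h)
    · intro α β hα hβ
      have := hcost α β _ hα (fun _ => h2 α β hα hβ) (fun h => absurd hz h)
      linarith
  · intro hz
    refine ⟨l, hlen, fun h => ?_, fun x y h α β hα hβ => ?_⟩
    · rw [Input.Correct, outputs_seqOps, hrun]
      exact outputs_testAll _ _ _ _ _ _ _ (fun h' => absurd (htest.mp h') hz) fun _ => h
    · have := hcost α β _ hα (fun h => absurd h hz) (fun _ => h α β hα hβ)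
      linarith

theorem finishCost_nonneg (N k : ℕ) : 0 ≤ finishCost N k := by
  unfold finishCost; positivity

/-- Try the directions of a list one after the other. -/
theorem exists_search (hc : 1 < c) (hN : 2 ≤ N) (hd : 1 ≤ d) (hk : d < 2 ^ k)
    (hk' : 2 ^ k ≤ 2 * d) (pos : Fin (N * d + 1) → ℕ) (cs : List (Fin d → Fin (N * d + 1))) (ℓ : ℕ) :
    ∃ T : Prog N d, ∀ (I : Input.{u} N d 8 c) (m : List I.R), m.length = ℓ →
      (∀ n, m[pos n]? = some (((n : ℕ) : I.R))) →
      ((∃ w ∈ cs, I.Good fun k => ((w k : ℕ) : ZMod I.p)) → I.Correct T m) ∧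
      I.CostLE T m (cs.length * (N * d) + finishCost N k) (cs.length * (N * d) + N) := by
  induction cs generalizing ℓ with
  | nil =>
    -- With no candidates left correctness is vacuous, so any output will do.
    refine ⟨.output 0, fun I m _ _ => ⟨by simp, fun α β hα hβ => ?_⟩⟩
    have := finishCost_nonneg N k
    simp only [Prog.expCost]
    positivity
  | cons w cs ih =>
    obtain ⟨F, hF⟩ := ih (ℓ + N * d)
    obtain ⟨T, hT⟩ := exists_attempt.{u} hc hN hd hk hk' ℓ (fun k => pos (w k)) F
    refine ⟨T, fun I m hm hpos => ?_⟩
    obtain ⟨h1, h2⟩ := hT I m (fun k => ((w k : ℕ) : ZMod I.p)) hm (fun k => by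
      rw [hpos, map_natCast])
    have hlen : (((w :: cs).length : ℕ) : ℝ) = cs.length + 1 := by simp
    rw [hlen]
    by_cases hz : I.Good fun k => ((w k : ℕ) : ZMod I.p)
    · obtain ⟨h3, h4⟩ := h1 hz
      refine ⟨fun _ => h3, fun α β hα hβ => (h4 α β hα hβ).trans ?_⟩
      have h5 : 0 ≤ α * (cs.length * (N * d)) := by positivity
      have h6 : 0 ≤ β * (cs.length * (N * d)) := by positivity
      linarith
    · obtain ⟨l, hl, h3, h4⟩ := h2 hz
      obtain ⟨h5, h6⟩ := hF I (m ++ l) (by simp [hm, hl]) fun n =>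
        getElem?_append_of_eq_some (hpos n) l
      refine ⟨fun ⟨w', hw', hgood⟩ => h3 (h5 ?_), fun α β hα hβ => (h4 _ _ h6 α β hα hβ).trans ?_⟩
      · rcases List.mem_cons.mp hw' with rfl | hw'
        · exact absurd hgood hz
        · exact ⟨w', hw', hgood⟩
      · linarith

/-- An exhaustive deterministic search, whose cost depends on `N` and `d` only. -/
theorem exists_exhaustive (hc : 1 < c) (hN : 2 ≤ N) (hd : 1 ≤ d) (hk : d < 2 ^ k)
    (hk' : 2 ^ k ≤ 2 * d) : ∃ M : ℝ, 0 ≤ M ∧ ∀ ℓ, ∃ T : Prog N d,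
      ∀ (I : Input.{u} N d 8 c) (m : List I.R), m.length = ℓ →
        I.Correct T m ∧ I.CostLE T m M M := by
  let cs : List (Fin d → Fin (N * d + 1)) := Finset.univ.toList
  have hfc := finishCost_nonneg N k
  refine ⟨((N * d + 1) * 2 : ℕ) + cs.length * (N * d) + finishCost N k + N, by positivity,
    fun ℓ => ?_⟩
  let ι := {e : (I : Input.{u} N d 8 c) × List I.R // e.2.length = ℓ}
  let R : ι → Type u := fun e => e.1.1.R
  have hcomp : Comp (fun k e => e.1.1.ω k : ℕ → ∀ e, R e) ((N * d + 1) * 2) ∅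
      (seg (fun n : ℕ => (n : ∀ e, R e)) (N * d + 1)) := by
    refine Comp.seg_of_prev fun i hi => ?_
    cases i with
    | zero =>
      rw [Nat.cast_zero]
      exact (Comp.of_step .zero).mono_time (by omega)
    | succ i =>
      rw [Nat.cast_succ]
      exact (Comp.of_mem (Set.mem_union_right _ (mem_seg (f := fun n : ℕ => (n : ∀ e, R e))
        (Nat.lt_succ_self i)))).add (Comp.of_step .one)
  obtain ⟨os, hos, hcost, hY⟩ := hcomp.realize (R := R) (fun e => e.1.1.ω) (fun e => e.1.1.S) ℓ
    (fun e => e.1.2) (fun e => e.2) (by simp)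
  have hY' : ∀ n : Fin (N * d + 1), ∃ q : ℕ, ∀ e : ι,
      (runOps e.1.1.ω e.1.1.S os e.1.2)[q]? = some (((n : ℕ) : e.1.1.R)) := fun n =>
    hY _ (mem_seg (f := fun n : ℕ => (n : ∀ e, R e)) n.2)
  choose pos hpos using hY'
  obtain ⟨T, hT⟩ := exists_search.{u} hc hN hd hk hk' pos cs (ℓ + os.length)
  refine ⟨seqOps os T, fun I m hm => ?_⟩
  have hlen : (runOps I.ω I.S os m).length = ℓ + os.length := by
    rw [length_runOps, hm]
  obtain ⟨h1, h2⟩ := hT I _ hlen fun n => hpos n ⟨⟨I, m⟩, hm⟩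
  constructor
  · rw [Input.Correct, outputs_seqOps]
    obtain ⟨w, hw⟩ := I.exists_good_grid hc (by omega) (by omega)
    exact h1 ⟨w, by simp [cs], hw⟩
  · intro α β hα hβ
    rw [expCost_seqOps, hcost]
    have h3 := h2 α β hα hβ
    have h4 : (os.length : ℝ) ≤ ((N * d + 1) * 2 : ℕ) := by exact_mod_cast hos
    have h5 := mul_le_mul_of_nonneg_right h4 hα
    have h6 : 0 ≤ β * (((N * d + 1) * 2 : ℕ) + finishCost N k) := by positivity
    have h7 : 0 ≤ α * N := by positivity
    linarith

/-- `K` random directions, followed by the exhaustive search. -/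
theorem exists_rounds (hc : 1 < c) (hN : 2 ≤ N) (hd : 1 ≤ d) (hk : d < 2 ^ k)
    (hk' : 2 ^ k ≤ 2 * d) : ∃ M : ℝ, 0 ≤ M ∧ ∀ K ℓ : ℕ, ∃ T : Prog N d,
      ∀ (I : Input.{u} N d 8 c) (m : List I.R), m.length = ℓ →
        I.Correct T m ∧ I.CostLE T m
          (c / (c - 1) * (d + N * d + finishCost N k) + M / c ^ K)
          (c / (c - 1) * (N * d + N) + M / c ^ K) := by
  obtain ⟨M, hM, hT⟩ := exists_exhaustive.{u} hc hN hd hk hk'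
  have hc0 : 0 < c := by linarith
  have hc1 : 0 < c - 1 := by linarith
  have hfc := finishCost_nonneg N k
  refine ⟨M, hM, fun K => ?_⟩
  induction K with
  | zero =>
    intro ℓ
    obtain ⟨T, hT⟩ := hT ℓ
    refine ⟨T, fun I m hm => ⟨(hT I m hm).1, fun α β hα hβ =>
      ((hT I m hm).2 α β hα hβ).trans ?_⟩⟩
    have h1 : 0 ≤ α * (c / (c - 1) * (d + N * d + finishCost N k)) := by positivity
    have h2 : 0 ≤ β * (c / (c - 1) * (N * d + N)) := by positivity
    simp only [pow_zero, div_one]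
    linarith
  | succ K ih =>
    intro ℓ
    -- A failed round leaves `d` samples and `N * d` exponents in memory.
    obtain ⟨F, hF⟩ := ih (ℓ + d + N * d)
    obtain ⟨T, hT⟩ := exists_attempt.{u} hc hN hd hk hk' (ℓ + d) (fun k => ℓ + k) F
    refine ⟨Prog.sample^[d] T, fun I m hm => ?_⟩
    have hT' := fun z : Fin d → ZMod I.p => hT I
      (m ++ List.ofFn fun k => algebraMap (ZMod I.p) I.R (z k)) z (by simp [hm]) (fun k => by
        rw [List.getElem?_append_right (by omega), List.getElem?_ofFn, dif_pos (by omega)]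
        congr 3
        ext
        simp [hm])
    constructor
    · refine outputs_sample_iterate _ _ _ _ _ _ fun z => ?_
      by_cases hz : I.Good z
      · exact ((hT' z).1 hz).1
      · obtain ⟨l, hl, h1, _⟩ := (hT' z).2 hz
        exact h1 (hF I _ (by simp [hm, hl]; omega)).1
    · intro α β hα hβ
      classical
      rw [expCost_sample_iterate]
      set X := c / (c - 1) * (d + N * d + finishCost N k) + M / c ^ K with hX
      set Y := c / (c - 1) * (N * d + N) + M / c ^ K with hY
      have hX0 : 0 ≤ X := by positivity
      have hY0 : 0 ≤ Y := by positivity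
      set G := α * (N * d + finishCost N k) + β * (N * d + N) with hG
      have hz : ∀ z : Fin d → ZMod I.p, T.expCost I.p α β I.ω I.S
          (m ++ List.ofFn fun k => algebraMap (ZMod I.p) I.R (z k)) ≤
            G + if ¬ I.Good z then α * X + β * Y else 0 := by
        intro z
        by_cases hz : I.Good z
        · rw [if_neg (by simpa using hz), add_zero]
          exact ((hT' z).1 hz).2 α β hα hβ
        · rw [if_pos hz]
          obtain ⟨l, hl, _, h1⟩ := (hT' z).2 hz
          refine (h1 _ _ (hF I _ (by simp [hm, hl]; omega)).2 α β hα hβ).trans ?_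
          have h2 : 0 ≤ α * finishCost N k := by positivity
          have h3 : 0 ≤ β * N := by positivity
          rw [hG]
          linarith
      have hsum := Finset.sum_le_sum fun z (_ : z ∈ Finset.univ) => hz z
      rw [Finset.sum_add_distrib, ← Finset.sum_filter, Finset.sum_const, Finset.sum_const,
        Finset.card_univ, nsmul_eq_mul, nsmul_eq_mul, Fintype.card_fun, ZMod.card,
        Fintype.card_fin] at hsum
      have hppos : (0 : ℝ) < (I.p : ℝ) ^ d := by
        have : (0 : ℝ) < I.p := by exact_mod_cast I.prime.out.pos
        positivity
      have hbad := I.card_bad_le hc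
      have hle : (∑ z : Fin d → ZMod I.p, T.expCost I.p α β I.ω I.S
          (m ++ List.ofFn fun k => algebraMap (ZMod I.p) I.R (z k))) / (I.p : ℝ) ^ d ≤
            G + (α * X + β * Y) / c := by
        rw [div_le_iff₀ hppos]
        refine hsum.trans ?_
        have h1 : ((Finset.univ.filter fun z : Fin d → ZMod I.p => ¬ I.Good z).card : ℝ) ≤
            (I.p : ℝ) ^ d / c := by rw [le_div_iff₀ hc0]; linarith
        have h2 := mul_le_mul_of_nonneg_right h1 (show 0 ≤ α * X + β * Y by positivity)
        push_cast
        refine (add_le_add_right h2 _).trans (le_of_eq ?_)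
        field_simp
      -- A round costs `D` and is followed by another with probability at most `1 / c`; `c / (c - 1)
      -- * D` is the fixed point of `E ↦ D + E / c`.
      have hfix : ∀ D : ℝ, D + (c / (c - 1) * D + M / c ^ K) / c =
          c / (c - 1) * D + M / c ^ (K + 1) := by
        intro D
        rw [pow_succ]
        field_simp
        ring
      rw [← hfix, ← hfix]
      refine (add_le_add_right hle _).trans (le_of_eq ?_)
      rw [hG, hX, hY]
      ring

/-- The program for `N ≥ 2`. -/
theorem exists_program (hc : 1 < c) (hN : 2 ≤ N) (hd : 1 ≤ d) :
    ∃ T : Prog N d, ∀ I : Input.{u} N d 8 c, I.Correct T [] ∧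
      I.CostLE T [] ((c / (c - 1) + 1) * 30000 * (N * Real.log (d + 1) ^ 2 * d))
        ((c / (c - 1) + 1) * 2 * (N * d)) := by
  set k := Nat.log 2 d + 1 with hkdef
  have hk : d < 2 ^ k := Nat.lt_pow_succ_log_self (by norm_num) d
  have hk' : 2 ^ k ≤ 2 * d := by
    have := Nat.pow_log_le_self 2 (show d ≠ 0 by omega)
    rw [hkdef, pow_succ]; omega
  obtain ⟨M, hM, h⟩ := exists_rounds.{u} hc hN hd hk hk'
  obtain ⟨K, hK⟩ := pow_unbounded_of_one_lt M hc
  obtain ⟨T, hT⟩ := h K 0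
  refine ⟨T, fun I => ⟨(hT I [] rfl).1, fun α β hα hβ =>
    ((hT I [] rfl).2 α β hα hβ).trans ?_⟩⟩
  have hMK : M / c ^ K ≤ 1 := by
    rw [div_le_one (by positivity)]; exact hK.le
  have hN' : (2 : ℝ) ≤ N := by exact_mod_cast hN
  have hd' : (1 : ℝ) ≤ d := by exact_mod_cast hd
  have hNd : (N : ℝ) ≤ N * d := by nlinarith
  have hdNd : (d : ℝ) ≤ N * d := by nlinarith
  have hq : 0 ≤ c / (c - 1) := div_nonneg (by linarith) (by linarith)
  set ℓ := Real.log (d + 1) with hℓ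
  have hlog2 : (0.6931 : ℝ) < Real.log 2 := by have := Real.log_two_gt_d9; linarith
  have hℓ2 : Real.log 2 ≤ ℓ := Real.log_le_log (by norm_num) (by linarith)
  -- Here `k + 1 = ⌊log₂ d⌋ + 2 ≤ 3ℓ / log 2`, which is below `5ℓ`.
  have hkℓ : ((k : ℝ) + 1) ≤ 5 * ℓ := by
    have h1 : (Nat.log 2 d : ℝ) * Real.log 2 ≤ ℓ := by
      rw [← Real.log_pow]
      refine Real.log_le_log (by positivity) ?_
      have := Nat.pow_log_le_self 2 (show d ≠ 0 by omega)
      have h2 : ((2 ^ Nat.log 2 d : ℕ) : ℝ) ≤ d := by exact_mod_cast this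
      push_cast at h2
      linarith
    rw [hkdef]
    push_cast
    have h3 : (0 : ℝ) ≤ Nat.log 2 d := by positivity
    nlinarith
  have hk2 : ((k : ℝ) + 1) ^ 2 ≤ 25 * ℓ ^ 2 := by
    have : (0 : ℝ) ≤ (k : ℝ) + 1 := by positivity
    nlinarith
  have h2k : (2 : ℝ) ^ k ≤ 2 * d := by exact_mod_cast hk'
  -- `17250 = 230 · (3/2) · 25 · 2`.
  have hτ : (230 : ℝ) * (N + 1) * (k + 1) ^ 2 * 2 ^ k ≤ 17250 * (N * ℓ ^ 2 * d) := by
    have h1 : ((k : ℝ) + 1) ^ 2 * 2 ^ k ≤ 25 * ℓ ^ 2 * (2 * d) :=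
      mul_le_mul hk2 h2k (by positivity) (by positivity)
    have h2 : (N : ℝ) + 1 ≤ 3 / 2 * N := by linarith
    have h3 : ((N : ℝ) + 1) * (((k : ℝ) + 1) ^ 2 * 2 ^ k) ≤
        3 / 2 * N * (25 * ℓ ^ 2 * (2 * d)) :=
      mul_le_mul h2 h1 (by positivity) (by positivity)
    nlinarith
  have hℓsq : (N : ℝ) * d ≤ 3 * (N * ℓ ^ 2 * d) := by
    have h1 : 1 ≤ 3 * ℓ ^ 2 := by nlinarith
    have h2 := mul_le_mul_of_nonneg_left h1 (show (0 : ℝ) ≤ N * d by positivity)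
    linarith
  have hfin : (d : ℝ) + N * d + finishCost N k ≤ 30000 * (N * ℓ ^ 2 * d) := by
    rw [finishCost]
    push_cast
    nlinarith
  have h1 : c / (c - 1) * (d + N * d + finishCost N k) + M / c ^ K ≤
      (c / (c - 1) + 1) * 30000 * (N * ℓ ^ 2 * d) := by
    have := mul_le_mul_of_nonneg_left hfin hq
    nlinarith
  have h2 : c / (c - 1) * (N * d + N) + M / c ^ K ≤ (c / (c - 1) + 1) * 2 * (N * d) := by
    have := mul_le_mul_of_nonneg_left (show (N : ℝ) * d + N ≤ 2 * (N * d) by linarith) hq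
    nlinarith
  exact add_le_add (mul_le_mul_of_nonneg_left h1 hα) (mul_le_mul_of_nonneg_left h2 hβ)

end LatticeCount

/-! ### The counting theorem -/

theorem mainTheorem9 :
    ∃ L : ℕ, ∀ c : ℝ, 1 < c → ∃ C : ℝ, ∀ N d : ℕ, 1 ≤ d →
      ∃ T : LatticeCount.Prog N d,
        ∀ (p : ℕ) [Fact p.Prime] (R : Type*) [CommRing R] [Nontrivial R] [Algebra (ZMod p) R]
          (ω : ℕ → R) (P : Set (Fin d → ℝ)) (S : LatticeCount.ShortSum N d),
          c * ((N : ℝ) * (d : ℝ)) ≤ (p : ℝ) →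
          (∀ k : ℕ, 2 ^ k ≤ L * d → LatticeCount.IsPrimRoot (ω k) (2 ^ k)) →
          LatticeCount.IsRationalPolytope P →
          S.Represents P →
          (∀ i j, ∃ k, ¬ (p : ℤ) ∣ S.v i j k) →
          T.Outputs p ω S (((LatticeCount.latticePoints P).ncard : ℕ) : R) [] ∧
          T.expTime p ω S ≤ C * ((N : ℝ) * Real.log ((d : ℝ) + 1) ^ 2 * (d : ℝ)) ∧
          T.expSubst p ω S ≤ C * ((N : ℝ) * (d : ℝ)) := by
  -- The running time adds the `2Nd` substitutions to the other steps, and `2Nd ≤ 6 N log²(d + 1)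
  -- d`; hence `30006 = 30000 + 6`.
  refine ⟨8, fun c hc => ⟨(c / (c - 1) + 1) * 30006, fun N d hd => ?_⟩⟩
  have hq : 0 ≤ c / (c - 1) := div_nonneg (by linarith) (by linarith)
  rcases Nat.lt_or_ge N 2 with hN | hN
  · refine ⟨.output 0, fun p _ R _ _ _ ω P S _ _ hP hS _ => ⟨?_, ?_, ?_⟩⟩
    · have hfin := LatticeCount.finite_latticePoints hP
      obtain rfl | rfl : N = 0 ∨ N = 1 := by omega
      · rw [LatticeCount.natCast_ncard_of_isEmpty hS hfin]
        rfl
      · exact absurd hS (LatticeCount.not_represents_one hd hfin)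
    · simp only [LatticeCount.Prog.expTime, LatticeCount.Prog.expCost]
      positivity
    · simp only [LatticeCount.Prog.expSubst, LatticeCount.Prog.expCost]
      positivity
  · obtain ⟨T, hT⟩ := LatticeCount.exists_program hc hN hd
    refine ⟨T, fun p _ R _ _ _ ω P S hp hω hP hS hv => ?_⟩
    obtain ⟨h1, h2⟩ := hT ⟨p, inferInstance, R, inferInstance, inferInstance, inferInstance, ω, P, S,
      hp, hω, hP, hS, hv⟩
    have hd' : (1 : ℝ) ≤ d := by exact_mod_cast hd
    have hlog : 1 ≤ 3 * Real.log ((d : ℝ) + 1) ^ 2 := by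
      have h3 := Real.log_two_gt_d9
      have h4 : Real.log 2 ≤ Real.log ((d : ℝ) + 1) := Real.log_le_log (by norm_num) (by linarith)
      nlinarith
    have hNd : (0 : ℝ) ≤ N * d := by positivity
    refine ⟨h1, (h2 1 1 zero_le_one zero_le_one).trans ?_, (h2 0 1 le_rfl zero_le_one).trans ?_⟩
    · have h5 := mul_le_mul_of_nonneg_left (mul_le_mul_of_nonneg_left hlog hNd)
        (show 0 ≤ (c / (c - 1) + 1) * 2 by positivity)
      nlinarith
    · have : 0 ≤ (c / (c - 1) + 1) * (N * d) := by positivity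
      nlinarith
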